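/- Let $n>m\ge 1$ be integers, let $V_{n,m}=\{v\in\mathbb R^{n\times m}: v'v=I_m\}$ be the Stiefel manifold ($'$ denotes the transpose), and let $dv$ be the $O(n)$-invariant measure on $V_{n,m}$ of total mass $\sigma_{n,m}=\prod_{i=1}^m |S^{n-i}|$, where $|S^{i}|=2\pi^{(i+1)/2}/\Gamma((i+1)/2)$. For a positive definite symmetric $m\times m$ matrix $r$ with leading principal minors $\Delta_0(r)=1,\Delta_1(r),\dots,\Delta_m(r)$ and for $\boldsymbol\lambda=(\lambda_1,\dots,\lambda_m)\in\mathbb C^m$ put $$r^{\boldsymbol\lambda}=\prod_{i=1}^m\left[\frac{\Delta_i(r)}{\Delta_{i-1}(r)}\right]^{\lambda_i/2},$$ and define the composite cosine transform of a function $f$ on $V_{n,m}$ by $$(T^{\boldsymbol\lambda}f)(u)=\int_{V_{n,m}} f(v)\,(u'vv'u)^{\boldsymbol\lambda}\,dv,\qquad u\in V_{n,m}$$ (for each $u$, the matrix $u'vv'u$ is positive definite for almost all $v$). Let $\mathfrak L$ be the set of all $\boldsymbol\lambda\in\mathbb C^m$ with $\operatorname{Re}\lambda_j>j-m-1$ for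 all $j=1,\dots,m$. 1. For $\boldsymbol\lambda\in\mathbb C^m$, the following are equivalent: (a) for every $f\in L^1(V_{n,m})$, the integral $(T^{\boldsymbol\lambda}f)(u)$ converges absolutely for almost every $u\in V_{n,m}$; (b) $\boldsymbol\lambda\in\mathfrak L$. 2. For every $f\in L^1(V_{n,m})$ and almost every $u\in V_{n,m}$ (with an exceptional null set that does not depend on $\boldsymbol\lambda$), the integral $(T^{\boldsymbol\lambda}f)(u)$ converges absolutely for all $\boldsymbol\lambda\in\mathfrak L$ and is an analytic function of $\boldsymbol\lambda\in\mathfrak L$. 3. For every $\boldsymbol\lambda\in\mathfrak L$, $T^{\boldsymbol\lambda}$ is a bounded linear operator on $L^1(V_{n,m})$. -/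

import Mathlib

open MeasureTheory Matrix

namespace CompositeCosine

/-- The orthogonal group `O(n)` of real orthogonal `n × n` matrices. -/
abbrev OGroup (n : ℕ) : Type := Matrix.orthogonalGroup (Fin n) ℝ

/-- The Stiefel manifold `V_{n,m}` of real `n × m` matrices `v` with `v' v = I_m`
(orthonormal `m`-frames in `ℝⁿ`), with the topology of the space of matrices. -/
abbrev Stiefel (n m : ℕ) : Type := {v : Matrix (Fin n) (Fin m) ℝ // vᵀ * v = 1}

instance instMeasurableSpaceOGroup (n : ℕ) : MeasurableSpace (OGroup n) := borel _

instance instBorelSpaceOGroup (n : ℕ) : BorelSpace (OGroup n) := ⟨rfl⟩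

instance instMeasurableSpaceStiefel (n m : ℕ) : MeasurableSpace (Stiefel n m) := borel _

instance instBorelSpaceStiefel (n m : ℕ) : BorelSpace (Stiefel n m) := ⟨rfl⟩

instance instCompactSpaceOGroup (n : ℕ) : CompactSpace (OGroup n) := by
  suffices h : IsCompact (Matrix.orthogonalGroup (Fin n) ℝ : Set (Matrix (Fin n) (Fin n) ℝ)) from
    isCompact_iff_compactSpace.1 h
  have hK : IsCompact {A : Matrix (Fin n) (Fin n) ℝ | ∀ i j, A i j ∈ Set.Icc (-1 : ℝ) 1} := by
    have h : IsCompact {A : Fin n → Fin n → ℝ | ∀ i j, A i j ∈ Set.Icc (-1 : ℝ) 1} := by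
      have h1 := isCompact_univ_pi (X := fun _ : Fin n => Fin n → ℝ)
        (s := fun _ => Set.pi Set.univ fun _ => Set.Icc (-1 : ℝ) 1)
        (fun _ => isCompact_univ_pi fun _ => isCompact_Icc)
      have h2 : {A : Fin n → Fin n → ℝ | ∀ i j, A i j ∈ Set.Icc (-1 : ℝ) 1} =
          Set.pi Set.univ fun _ => Set.pi Set.univ fun _ => Set.Icc (-1 : ℝ) 1 := by
        ext A
        simp only [Set.mem_ofPred_eq, Set.mem_pi, Set.mem_univ, true_implies]
      rw [h2]
      exact h1
    exact h
  have hc : IsClosed {A : Matrix (Fin n) (Fin n) ℝ | A * Aᵀ = 1} :=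
    isClosed_eq (by fun_prop) continuous_const
  refine (hK.inter_right hc).of_isClosed_subset ?_ ?_
  · convert hc using 1
    ext A
    exact Matrix.mem_orthogonalGroup_iff _ _
  · intro A hA
    refine ⟨fun i j => ?_, (Matrix.mem_orthogonalGroup_iff _ _).1 hA⟩
    have h := entry_norm_bound_of_unitary hA i j
    rw [Real.norm_eq_abs] at h
    exact abs_le.1 h

/-- The frame formed by the first `m` columns of an orthogonal matrix `γ`, that is `γ e` with
`e ∈ V_{n,m}` the standard frame. This is the quotient map `O(n) → O(n)/O(n-m) = V_{n,m}`. -/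
def frame {n m : ℕ} (h : m ≤ n) (γ : OGroup n) : Stiefel n m :=
  ⟨γ.1.submatrix id (Fin.castLE h), by
    have h1 : (γ.1)ᵀ * γ.1 = 1 := (Matrix.mem_orthogonalGroup_iff' _ _).1 γ.2
    ext i j
    have h2 := congrFun (congrFun h1 (Fin.castLE h i)) (Fin.castLE h j)
    simpa [Matrix.mul_apply, Matrix.one_apply, Fin.ext_iff] using h2⟩

theorem continuous_frame {n m : ℕ} (h : m ≤ n) : Continuous (frame (m := m) h) :=
  Continuous.subtype_mk (continuous_subtype_val.matrix_submatrix _ _) _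

/-- The Haar measure of the compact group `O(n)`, of total mass one. -/
noncomputable def haarO (n : ℕ) : Measure (OGroup n) := Measure.haarMeasure ⊤

/-- The surface area `2 π^{(i+1)/2} / Γ((i+1)/2)` of the `i`-dimensional unit sphere. -/
noncomputable def sphereArea (i : ℕ) : ℝ :=
  2 * Real.pi ^ (((i : ℝ) + 1) / 2) / Real.Gamma (((i : ℝ) + 1) / 2)

/-- The volume `σ_{n,m} = ∏_{i=1}^{m} |S^{n-i}|` of the Stiefel manifold (for `m ≤ n`); the
factor with index `i : Fin m` is that of number `i + 1`. -/
noncomputable def stiefelVolume (n m : ℕ) : ℝ := ∏ i : Fin m, sphereArea (n - (i + 1))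

/-- The `O(n)`-invariant measure `dv` on `V_{n,m} = O(n)/O(n-m)` of total mass `σ_{n,m}`: the image
of the Haar measure of `O(n)`, multiplied by `σ_{n,m}`. -/
noncomputable def stiefelMeasure {n m : ℕ} (h : m ≤ n) : Measure (Stiefel n m) :=
  ENNReal.ofReal (stiefelVolume n m) • (haarO n).map (frame h)

/-- The leading principal minor `Δ_k(r)` of order `k`; `Δ_0(r) = 1`. -/
def leadingMinor {m : ℕ} (r : Matrix (Fin m) (Fin m) ℝ) (k : ℕ) (hk : k ≤ m) : ℝ :=
  (r.submatrix (Fin.castLE hk) (Fin.castLE hk)).det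

/-- The composite power function
`r^lam = ∏_{i=1}^{m} (Δ_i(r) / Δ_{i-1}(r))^{lam_i / 2}`, `lam ∈ ℂᵐ`, of the cone of positive
definite symmetric matrices, on which all the ratios are positive. The index `i : Fin m` stands for
the number `i + 1`. (Values off the cone are immaterial: below, `r = u' v v' u` is always positive
semidefinite, and for each `u` it is singular only for `v` in a null set.) -/
noncomputable def compositePower {m : ℕ} (r : Matrix (Fin m) (Fin m) ℝ) (lam : Fin m → ℂ) : ℂ :=
  ∏ i : Fin m,
    ((leadingMinor r (i + 1) i.isLt / leadingMinor r i i.isLt.le : ℝ) : ℂ) ^ (lam i / 2)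

/-- The kernel `(u' v v' u)^lam`. -/
noncomputable def kernel {n m : ℕ} (lam : Fin m → ℂ) (u v : Stiefel n m) : ℂ :=
  compositePower (u.1ᵀ * v.1 * v.1ᵀ * u.1) lam

/-- The integral defining `(T^lam f)(u)` converges absolutely. -/
def ConvergesAt {n m : ℕ} (h : m ≤ n) (lam : Fin m → ℂ) (f : Stiefel n m → ℂ)
    (u : Stiefel n m) : Prop :=
  Integrable (fun v => f v * kernel lam u v) (stiefelMeasure h)

/-- The composite cosine transform `(T^lam f)(u) = ∫_{V_{n,m}} f(v) (u' v v' u)^lam dv`. -/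
noncomputable def cosineTransform {n m : ℕ} (h : m ≤ n) (lam : Fin m → ℂ)
    (f : Stiefel n m → ℂ) (u : Stiefel n m) : ℂ :=
  ∫ v, f v * kernel lam u v ∂(stiefelMeasure h)

/-- The set of all `lam ∈ ℂᵐ` with `Re lam_j > j - m - 1` for `j = 1, …, m`. The index `j : Fin m`
stands for the number `j + 1`. -/
def domain (m : ℕ) : Set (Fin m → ℂ) :=
  {lam | ∀ j : Fin m, ((j : ℝ) + 1) - m - 1 < (lam j).re}

end CompositeCosine

/-! Everything rests on the total mass of `|(u'vv'u)^lam|`, computed by integrating a Gaussian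
matrix in two ways. Write `a i` for the real part of `lam i`, with `i` counted from zero.

A ratio of consecutive leading minors of a Gram matrix is the squared distance of a vector from the
span of its predecessors. For independent standard Gaussian vectors in dimension `N`, that residual
is standard Gaussian in dimension `N - i`, so the Gaussian mean of the weight is the product of the
radial moments `E‖g‖^(a i)` in dimensions `N - i`
(`ae_linearIndependent_and_lintegral_weight_gram`).

Let `x` be a Gaussian `n × m` matrix, `e` the standard frame and `γ` Haar distributed on `O(n)`. For
each `γ`, the matrix `e'γx` is Gaussian of size `m × m`. For each independent `x = ηeT`, with `η`
orthogonal and `T` upper triangular, the weight of `e'γx` is the weight of the kernel matrix for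
`γηe` and `e` times that of `x'x`. Averaging in both orders gives
`kernelMass_mul_prod_radialMoment`: the mass times the moments in dimensions `n - i` equals the
product of those in dimensions `m - i`. A moment in dimension `d` is finite exactly when the
exponent exceeds `-d`, so the mass is finite exactly when `a i > i - m` for all `i`
(`kernelMass_lt_top_iff`), which is the stated domain.

By invariance the mass does not depend on the fixed frame. Tonelli then gives almost everywhere
convergence and the `L¹` bound, and `f = 1` gives necessity. Since the minor ratios lie in `[0, 1]`,
the weight decreases in the exponents, so countably many exponents near the boundary control the
whole domain. The kernel is an exponential of a linear form in `lam`, which yields a convergent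
power series. -/

namespace CompositeCosine

open ProbabilityTheory Module
open scoped ENNReal InnerProductSpace

/-! ### Standard Gaussian measures and their radial moments. -/

section Gaussian

variable {E : Type*} [NormedAddCommGroup E] [InnerProductSpace ℝ E] [FiniteDimensional ℝ E]
  [MeasurableSpace E] [BorelSpace E]
  {F : Type*} [NormedAddCommGroup F] [InnerProductSpace ℝ F] [FiniteDimensional ℝ F]
  [MeasurableSpace F] [BorelSpace F]

/-- A co-isometry maps the standard Gaussian measure to the standard Gaussian measure. -/
theorem map_stdGaussian_of_adjoint_isometry (B : E →L[ℝ] F)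
    (hB : ∀ t, ‖ContinuousLinearMap.adjoint B t‖ = ‖t‖) :
    (stdGaussian E).map B = stdGaussian F := by
  have : IsProbabilityMeasure ((stdGaussian E).map B) :=
    Measure.isProbabilityMeasure_map B.continuous.aemeasurable
  apply Measure.ext_of_charFun
  ext t
  -- The Gaussian characteristic function depends only on the norm, and `⟪B x, t⟫ = ⟪x, B* t⟫`.
  rw [charFun_stdGaussian, ← hB t, ← charFun_stdGaussian, charFun_apply, charFun_apply,
    integral_map B.continuous.aemeasurable (by fun_prop)]
  simp_rw [ContinuousLinearMap.adjoint_inner_right]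

variable (E) in
/-- The standard Gaussian measure has the usual density. -/
theorem stdGaussian_eq_withDensity : ∃ c : ℝ, 0 < c ∧ stdGaussian E =
    (volume : Measure E).withDensity
      (fun x => ENNReal.ofReal (c * Real.exp (-(1 / 2) * ‖x‖ ^ 2))) := by
  set c : ℝ := ((Real.pi / (1 / 2)) ^ (finrank ℝ E / 2 : ℝ))⁻¹ with hc
  have hc0 : 0 < c := by positivity
  refine ⟨c, hc0, ?_⟩
  have hmeas : Measurable fun x : E => ENNReal.ofReal (c * Real.exp (-(1 / 2) * ‖x‖ ^ 2)) := by
    fun_prop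
  have hint : Integrable (fun x : E => Real.exp (-(1 / 2) * ‖x‖ ^ 2)) := by
    have h := (GaussianFourier.integrable_cexp_neg_mul_sq_norm_add (V := E) (b := ((1 / 2 : ℝ) : ℂ))
      (by norm_num) 0 0).norm
    refine h.congr (.of_forall fun x => ?_)
    simp only [zero_mul, add_zero]
    rw [Complex.norm_exp]
    congr 1
    rw [← Complex.ofReal_pow, ← Complex.ofReal_neg, ← Complex.ofReal_mul, Complex.ofReal_re]
  have : IsFiniteMeasure ((volume : Measure E).withDensity
      (fun x => ENNReal.ofReal (c * Real.exp (-(1 / 2) * ‖x‖ ^ 2)))) :=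
    isFiniteMeasure_withDensity_ofReal (hint.const_mul c).hasFiniteIntegral
  apply Measure.ext_of_charFun
  ext t
  rw [charFun_stdGaussian, charFun_apply,
    integral_withDensity_eq_integral_toReal_smul hmeas (.of_forall fun _ => ENNReal.ofReal_lt_top)]
  have h := GaussianFourier.integral_cexp_neg_mul_sq_norm_add (V := E) (b := ((1 / 2 : ℝ) : ℂ))
      (by norm_num) Complex.I t
  have h2 : ∀ x : E, (ENNReal.ofReal (c * Real.exp (-(1 / 2) * ‖x‖ ^ 2))).toReal •
      Complex.exp (⟪x, t⟫_ℝ * Complex.I) = (c : ℂ) *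
        Complex.exp (-((1 / 2 : ℝ) : ℂ) * ‖x‖ ^ 2 + Complex.I * ⟪t, x⟫_ℝ) := by
    intro x
    rw [ENNReal.toReal_ofReal (by positivity), Complex.real_smul, Complex.exp_add,
      real_inner_comm]
    push_cast
    ring_nf
  simp_rw [h2]
  rw [integral_const_mul, h, ← mul_assoc]
  have h3 : ((Real.pi : ℂ) / ((1 / 2 : ℝ) : ℂ)) ^ (finrank ℝ E / 2 : ℂ) = ((c⁻¹ : ℝ) : ℂ) := by
    rw [hc, inv_inv, Complex.ofReal_cpow (by positivity)]
    push_cast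
    rfl
  rw [h3, ← Complex.ofReal_mul, mul_inv_cancel₀ hc0.ne', Complex.ofReal_one, one_mul]
  congr 1
  simp only [Complex.I_sq]
  push_cast
  ring

variable (E) in
theorem stdGaussian_absolutelyContinuous : stdGaussian E ≪ volume := by
  obtain ⟨c, -, h⟩ := stdGaussian_eq_withDensity E
  rw [h]
  exact withDensity_absolutelyContinuous _ _

/-- The moments of the norm of a standard Gaussian vector. -/
noncomputable def radialMoment (d : ℕ) (a : ℝ) : ℝ≥0∞ :=
  ∫⁻ x, ENNReal.ofReal (‖x‖ ^ 2) ^ (a / 2) ∂(stdGaussian (EuclideanSpace ℝ (Fin d)))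

theorem lintegral_norm_rpow_stdGaussian (a : ℝ) :
    ∫⁻ x, ENNReal.ofReal (‖x‖ ^ 2) ^ (a / 2) ∂(stdGaussian E) = radialMoment (finrank ℝ E) a := by
  have e := (stdOrthonormalBasis ℝ E).repr
  rw [radialMoment, ← stdGaussian_map e, lintegral_map (by fun_prop) (by fun_prop)]
  simp

theorem radialMoment_pos {d : ℕ} (hd : 0 < d) (a : ℝ) : 0 < radialMoment d a := by
  have : Nonempty (Fin d) := ⟨⟨0, hd⟩⟩
  rw [radialMoment, pos_iff_ne_zero, Ne, lintegral_eq_zero_iff (by fun_prop)]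
  intro h
  have h0 : ∀ᵐ x ∂(stdGaussian (EuclideanSpace ℝ (Fin d))), x ≠ 0 := by
    refine (stdGaussian_absolutelyContinuous _).ae_le ?_
    exact Measure.ae_ne _ 0
  have h1 : ∀ᵐ x ∂(stdGaussian (EuclideanSpace ℝ (Fin d))), False := by
    filter_upwards [h, h0] with x hx hx0
    have : 0 < ‖x‖ := norm_pos_iff.2 hx0
    have h2 := ENNReal.rpow_pos (p := a / 2) (ENNReal.ofReal_pos.2 (pow_pos this 2))
      ENNReal.ofReal_ne_top
    exact h2.ne' hx
  exact IsProbabilityMeasure.ne_zero _ (by simpa using h1)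

/-- Polar coordinates reduce the moment to the integral of `y^(d-1+a) exp(-y²/2)` on the half-line,
where only the singularity at `0` matters. -/
theorem radialMoment_lt_top_iff {d : ℕ} (hd : 0 < d) (a : ℝ) :
    radialMoment d a < ∞ ↔ -(d : ℝ) < a := by
  have : Nonempty (Fin d) := ⟨⟨0, hd⟩⟩
  obtain ⟨c, hc, h⟩ := stdGaussian_eq_withDensity (EuclideanSpace ℝ (Fin d))
  have h1 : radialMoment d a = ∫⁻ x : EuclideanSpace ℝ (Fin d),
      ENNReal.ofReal (c * (‖x‖ ^ a * Real.exp (-(1 / 2) * ‖x‖ ^ 2))) := by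
    rw [radialMoment, h, lintegral_withDensity_eq_lintegral_mul _ (by fun_prop) (by fun_prop)]
    refine lintegral_congr_ae ?_
    filter_upwards [Measure.ae_ne volume (0 : EuclideanSpace ℝ (Fin d))] with x hx
    have hx : 0 < ‖x‖ := norm_pos_iff.2 hx
    rw [Pi.mul_apply, ENNReal.ofReal_rpow_of_pos (by positivity),
      ← ENNReal.ofReal_mul (by positivity), ← Real.rpow_natCast, ← Real.rpow_mul hx.le]
    congr 1
    push_cast
    rw [show 2 * (a / 2) = a by ring]
    ring
  have hmeas : AEStronglyMeasurable (fun x : EuclideanSpace ℝ (Fin d) =>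
      c * (‖x‖ ^ a * Real.exp (-(1 / 2) * ‖x‖ ^ 2))) :=
    Measurable.aestronglyMeasurable (by fun_prop)
  rw [h1, lt_top_iff_ne_top, lintegral_ofReal_ne_top_iff_integrable hmeas
    (.of_forall fun x => by positivity), integrable_const_mul_iff hc.ne'.isUnit,
    integrable_fun_norm_addHaar volume
      (f := fun r : ℝ => r ^ a * Real.exp (-(1 / 2) * r ^ 2))]
  have h2 : ∀ y ∈ Set.Ioi (0 : ℝ), y ^ (finrank ℝ (EuclideanSpace ℝ (Fin d)) - 1) •
      (y ^ a * Real.exp (-(1 / 2) * y ^ 2)) =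
      y ^ ((d : ℝ) - 1 + a) * Real.exp (-(1 / 2) * y ^ 2) := by
    intro y hy
    rw [finrank_euclideanSpace_fin, smul_eq_mul, ← mul_assoc, ← Real.rpow_natCast,
      ← Real.rpow_add hy, Nat.cast_sub hd, Nat.cast_one]
  rw [integrableOn_congr_fun h2 measurableSet_Ioi]
  constructor
  · intro h3
    have h4 : IntegrableOn (fun y : ℝ => y ^ ((d : ℝ) - 1 + a)) (Set.Ioo 0 1) := by
      -- On `(0, 1)` the Gaussian factor is at least `exp (-1/2)`, so this constant compensates for
      -- dropping it.
      have h5 := (h3.mono_set (fun y hy => hy.1 : Set.Ioo (0 : ℝ) 1 ⊆ Set.Ioi 0)).const_mul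
        (Real.exp (1 / 2))
      refine h5.mono' (Measurable.aestronglyMeasurable (by fun_prop)) ?_
      filter_upwards [ae_restrict_mem measurableSet_Ioo] with y hy
      have hy0 : 0 < y ^ ((d : ℝ) - 1 + a) := Real.rpow_pos_of_pos hy.1 _
      rw [Real.norm_of_nonneg hy0.le, mul_left_comm, ← Real.exp_add]
      refine le_mul_of_one_le_right hy0.le (Real.one_le_exp ?_)
      nlinarith [hy.1, hy.2]
    rw [intervalIntegral.integrableOn_Ioo_rpow_iff one_pos] at h4
    linarith
  · intro h3
    exact integrableOn_rpow_mul_exp_neg_mul_sq (by norm_num) (by linarith)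

end Gaussian

end CompositeCosine

namespace CompositeCosine

open ProbabilityTheory Module
open scoped ENNReal InnerProductSpace

/-! ### Minor ratios and the real composite power. -/

section Weight

variable {m : ℕ}

/-- The ratio of two consecutive leading principal minors. -/
noncomputable def minorRatio (r : Matrix (Fin m) (Fin m) ℝ) (i : Fin m) : ℝ :=
  leadingMinor r (i + 1) i.isLt / leadingMinor r i i.isLt.le

/-- The composite power function with real exponents, as an extended nonnegative number. -/
noncomputable def weight (a : Fin m → ℝ) (r : Matrix (Fin m) (Fin m) ℝ) : ℝ≥0∞ :=
  ∏ i, ENNReal.ofReal (minorRatio r i) ^ (a i / 2)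

variable {X : Type*} [TopologicalSpace X]

theorem continuous_leadingMinor {r : X → Matrix (Fin m) (Fin m) ℝ} (hr : Continuous r)
    (k : ℕ) (hk : k ≤ m) : Continuous fun x => leadingMinor (r x) k hk :=
  (hr.matrix_submatrix _ _).matrix_det

theorem measurable_minorRatio [MeasurableSpace X] [OpensMeasurableSpace X]
    {r : X → Matrix (Fin m) (Fin m) ℝ} (hr : Continuous r) (i : Fin m) :
    Measurable fun x => minorRatio (r x) i :=
  (continuous_leadingMinor hr _ _).measurable.div (continuous_leadingMinor hr _ _).measurable

theorem measurable_weight [MeasurableSpace X] [OpensMeasurableSpace X] (a : Fin m → ℝ)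
    {r : X → Matrix (Fin m) (Fin m) ℝ} (hr : Continuous r) :
    Measurable fun x => weight a (r x) :=
  Finset.measurable_prod _ fun i _ => (measurable_minorRatio hr i).ennreal_ofReal.pow_const _

end Weight

/-! ### Gram determinants and Gaussian integrals of the weight. -/

section Gram

variable {E : Type*} [NormedAddCommGroup E] [InnerProductSpace ℝ E] [FiniteDimensional ℝ E]

/-- The orthogonal projection onto the orthogonal complement of the span of a family. -/
noncomputable def rejection {k : ℕ} (x : Fin k → E) :
    E →L[ℝ] (Submodule.span ℝ (Set.range x))ᗮ :=
  (Submodule.span ℝ (Set.range x))ᗮ.orthogonalProjectionOnto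

/-- Base times height, squared: replacing `y` by its component `z` orthogonal to the span is a
column operation, and then only the corner `‖z‖²` of the last column survives. -/
theorem det_gram_snoc {k : ℕ} (x : Fin k → E) (y : E) :
    (gram ℝ (Fin.snoc x y : Fin (k + 1) → E)).det = (gram ℝ x).det * ‖rejection x y‖ ^ 2 := by
  set W := Submodule.span ℝ (Set.range x) with hW
  set z : E := (rejection x y : E) with hz
  have hzW : z ∈ Wᗮ := (rejection x y).2
  have hsplit : (W.orthogonalProjectionOnto y : E) + z = y := by
    have h := W.starProjection_add_starProjection_orthogonal y
    exact h
  obtain ⟨c, hc⟩ := (Submodule.mem_span_range_iff_exists_fun ℝ).1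
    (W.orthogonalProjectionOnto y).2
  have hxz : ∀ i, ⟪x i, z⟫_ℝ = 0 := fun i =>
    (Submodule.mem_orthogonal W z).1 hzW _ (Submodule.subset_span ⟨i, rfl⟩)
  have hyz : ⟪y, z⟫_ℝ = ‖z‖ ^ 2 := by
    rw [← hsplit, inner_add_left, real_inner_self_eq_norm_sq,
      (Submodule.mem_orthogonal W z).1 hzW _ (Submodule.coe_mem _), zero_add]
  set u : Fin (k + 1) → E := Fin.snoc x y with hu
  set u' : Fin (k + 1) → E := Fin.snoc x z with hu'
  set B : Matrix (Fin (k + 1)) (Fin (k + 1)) ℝ := of fun i j => ⟪u i, u' j⟫_ℝ with hB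
  set d : Fin (k + 1) → ℝ := Fin.snoc c 1 with hd
  -- Since `y = ∑ c j • x j + z`, the last Gram column is this combination of the columns of `B`,
  -- the last one having coefficient `1`.
  have h1 : gram ℝ u = B.updateCol (Fin.last k) (fun i => ∑ j, d j • B i j) := by
    ext i j
    refine Fin.lastCases ?_ (fun j => ?_) j
    · rw [updateCol_self, Fin.sum_univ_castSucc]
      simp only [gram_apply, hB, of_apply, hd, hu', Fin.snoc_castSucc, Fin.snoc_last, smul_eq_mul,
        one_mul]
      conv_lhs => rw [show u (Fin.last k) = y by simp [hu], ← hsplit, ← hc, inner_add_right,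
        inner_sum]
      simp_rw [inner_smul_right]
    · rw [updateCol_ne (Fin.castSucc_lt_last j).ne]
      simp [gram_apply, hB, hu, hu']
  have h2 : (gram ℝ u).det = B.det := by
    rw [h1, det_updateCol_sum]
    simp [hd]
  rw [h2, det_succ_column _ (Fin.last k), Finset.sum_eq_single (Fin.last k)]
  · have h3 : B.submatrix (Fin.last k).succAbove (Fin.last k).succAbove = gram ℝ x := by
      ext i j
      simp [hB, gram_apply, hu, hu']
    rw [h3, Even.neg_one_pow ⟨_, rfl⟩]
    have h4 : B (Fin.last k) (Fin.last k) = ‖rejection x y‖ ^ 2 := by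
      simp only [hB, of_apply, hu, hu', Fin.snoc_last, hyz]
      rfl
    rw [h4]
    ring
  · intro i _ hi
    have h5 : B i (Fin.last k) = 0 := by
      obtain ⟨j, rfl⟩ := Fin.exists_castSucc_eq.2 hi
      simp [hB, hu, hu', hxz]
    rw [h5]
    ring
  · simp

/-- The uncancelled quotient is `1` for independent predecessors and `0` otherwise, so no
independence is needed. -/
theorem minorRatio_gram {m : ℕ} (x : Fin m → E) (i : Fin m) :
    minorRatio (gram ℝ x) i =
      (gram ℝ fun j : Fin i => x (Fin.castLE i.isLt.le j)).det /
        (gram ℝ fun j : Fin i => x (Fin.castLE i.isLt.le j)).det *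
        ‖rejection (fun j : Fin i => x (Fin.castLE i.isLt.le j)) (x i)‖ ^ 2 := by
  have h := det_gram_snoc (fun j : Fin i => x (Fin.castLE i.isLt.le j)) (x i)
  have h1 : leadingMinor (gram ℝ x) (i + 1) i.isLt = (gram ℝ (Fin.snoc
      (fun j : Fin i => x (Fin.castLE i.isLt.le j)) (x i) : Fin (i + 1) → E)).det := by
    unfold leadingMinor
    congr 1
    have h2 : (Fin.snoc (fun j : Fin i => x (Fin.castLE i.isLt.le j)) (x i) : Fin (i + 1) → E) =
        fun j => x (Fin.castLE i.isLt j) := by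
      ext j
      refine Fin.lastCases ?_ (fun j => ?_) j
      · rw [Fin.snoc_last]
        rfl
      · rw [Fin.snoc_castSucc]
        rfl
    rw [h2]
    rfl
  rw [minorRatio, h1, h, mul_div_right_comm]
  rfl

theorem minorRatio_gram_nonneg {m : ℕ} (x : Fin m → E) (i : Fin m) :
    0 ≤ minorRatio (gram ℝ x) i := by
  rw [minorRatio_gram]
  rcases eq_or_ne (gram ℝ fun j : Fin i => x (Fin.castLE i.isLt.le j)).det 0 with h | h
  · simp [h]
  · rw [div_self h, one_mul]
    positivity

theorem norm_rejection_le {k : ℕ} (x : Fin k → E) (y : E) : ‖rejection x y‖ ≤ ‖y‖ :=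
  Submodule.norm_orthogonalProjectionOnto_apply_le _ _

theorem minorRatio_gram_le {m : ℕ} (x : Fin m → E) (i : Fin m) :
    minorRatio (gram ℝ x) i ≤ ‖x i‖ ^ 2 := by
  rw [minorRatio_gram]
  rcases eq_or_ne (gram ℝ fun j : Fin i => x (Fin.castLE i.isLt.le j)).det 0 with h | h
  · rw [h, div_zero, zero_mul]
    positivity
  · rw [div_self h, one_mul]
    exact pow_le_pow_left₀ (norm_nonneg _) (norm_rejection_le _ _) 2

theorem weight_gram_snoc {k : ℕ} (a : Fin (k + 1) → ℝ) {x : Fin k → E}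
    (hx : LinearIndependent ℝ x) (y : E) :
    weight a (gram ℝ (Fin.snoc x y : Fin (k + 1) → E)) =
      weight (fun i => a i.castSucc) (gram ℝ x) *
        ENNReal.ofReal (‖rejection x y‖ ^ 2) ^ (a (Fin.last k) / 2) := by
  have hdet : (gram ℝ x).det ≠ 0 := det_gram_ne_zero_iff_linearIndependent.2 hx
  have h1 : minorRatio (gram ℝ (Fin.snoc x y : Fin (k + 1) → E)) (Fin.last k) =
      ‖rejection x y‖ ^ 2 := by
    have h := minorRatio_gram (Fin.snoc x y : Fin (k + 1) → E) (Fin.last k)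
    have h2 : (fun j : Fin (Fin.last k : Fin (k + 1)) => (Fin.snoc x y : Fin (k + 1) → E)
        (Fin.castLE (Fin.last k).isLt.le j)) = x := by
      ext j
      exact Fin.snoc_castSucc (α := fun _ => E) y x j
    rw [h2, Fin.snoc_last] at h
    rw [h]
    change (gram ℝ x).det / (gram ℝ x).det * _ = _
    rw [div_self hdet, one_mul]
  have h3 : ∀ i : Fin k, minorRatio (gram ℝ (Fin.snoc x y : Fin (k + 1) → E)) i.castSucc =
      minorRatio (gram ℝ x) i := by
    intro i
    have h4 : ∀ (l : ℕ) (hl : l ≤ k), leadingMinor (gram ℝ (Fin.snoc x y : Fin (k + 1) → E)) l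
        (hl.trans k.le_succ) = leadingMinor (gram ℝ x) l hl := by
      intro l hl
      unfold leadingMinor
      congr 1
      ext p q
      have h5 : ∀ p : Fin l, (Fin.snoc x y : Fin (k + 1) → E)
          (Fin.castLE (hl.trans k.le_succ) p) = x (Fin.castLE hl p) := fun p =>
        Fin.snoc_castSucc (α := fun _ => E) y x (Fin.castLE hl p)
      simp only [submatrix_apply, gram_apply, h5]
    exact congrArg₂ (· / ·) (h4 (i + 1) i.isLt) (h4 i i.isLt.le)
  rw [weight, Fin.prod_univ_castSucc, h1]
  simp_rw [h3]
  rfl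

omit [FiniteDimensional ℝ E] in
theorem continuous_gram {m : ℕ} : Continuous fun x : Fin m → E => gram ℝ x :=
  continuous_matrix fun i j => by
    simp only [gram_apply]
    fun_prop

variable [MeasurableSpace E] [BorelSpace E]

/-- Orthogonal projection sends the standard Gaussian to the standard Gaussian of the complement, of
dimension `finrank ℝ E - k`. -/
theorem lintegral_rejection {k : ℕ} {x : Fin k → E} (hx : LinearIndependent ℝ x) (a : ℝ) :
    ∫⁻ y, ENNReal.ofReal (‖rejection x y‖ ^ 2) ^ (a / 2) ∂(stdGaussian E) =
      radialMoment (finrank ℝ E - k) a := by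
  have h1 : (stdGaussian E).map (rejection x) =
      stdGaussian (Submodule.span ℝ (Set.range x))ᗮ := by
    apply map_stdGaussian_of_adjoint_isometry
    intro t
    rw [rejection, Submodule.adjoint_orthogonalProjectionOnto]
    rfl
  have h2 : finrank ℝ (Submodule.span ℝ (Set.range x))ᗮ = finrank ℝ E - k := by
    have h3 := (Submodule.span ℝ (Set.range x)).finrank_add_finrank_orthogonal
    rw [finrank_span_eq_card hx, Fintype.card_fin] at h3
    omega
  rw [← h2, ← lintegral_norm_rpow_stdGaussian, ← h1, lintegral_map (by fun_prop)
    (rejection x).continuous.measurable]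

omit [NormedAddCommGroup E] [InnerProductSpace ℝ E] [FiniteDimensional ℝ E] [BorelSpace E] in
theorem measurePreserving_snoc (ν : Measure E) [SigmaFinite ν] (k : ℕ) :
    MeasurePreserving (fun p : (Fin k → E) × E => (Fin.snoc p.1 p.2 : Fin (k + 1) → E))
      ((Measure.pi fun _ => ν).prod ν) (Measure.pi fun _ => ν) := by
  have h := ((measurePreserving_piFinSuccAbove (fun _ : Fin (k + 1) => ν) (Fin.last k)).symm).comp
    (Measure.measurePreserving_swap (μ := Measure.pi fun _ : Fin k => ν) (ν := ν))
  convert h using 1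
  ext p : 1
  exact (Fin.insertNth_last' p.2 p.1).symm

/-- Induction on the number of vectors, integrating over the last one first. Both claims go together
because that inner integral is known only when the earlier vectors are independent. -/
theorem ae_linearIndependent_and_lintegral_weight_gram {m : ℕ} (hm : m ≤ finrank ℝ E)
    (a : Fin m → ℝ) :
    (∀ᵐ x ∂(Measure.pi fun _ : Fin m => stdGaussian E), LinearIndependent ℝ x) ∧
      ∫⁻ x, weight a (gram ℝ x) ∂(Measure.pi fun _ : Fin m => stdGaussian E) =
        ∏ i : Fin m, radialMoment (finrank ℝ E - i) (a i) := by
  induction m with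
  | zero =>
    refine ⟨.of_forall fun x => linearIndependent_empty_type, ?_⟩
    simp [weight]
  | succ k ih =>
    obtain ⟨hli, hint⟩ := ih (by omega) (fun i => a i.castSucc)
    have hmp := measurePreserving_snoc (stdGaussian E) k
    constructor
    · have hms : MeasurableSet {x : Fin (k + 1) → E | LinearIndependent ℝ x} := by
        have : {x : Fin (k + 1) → E | LinearIndependent ℝ x} = {x | (gram ℝ x).det ≠ 0} := by
          ext x
          exact det_gram_ne_zero_iff_linearIndependent.symm
        rw [this]
        exact (continuous_gram.matrix_det.measurable (measurableSet_singleton 0)).compl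
      rw [← hmp.map_eq, ae_map_iff hmp.measurable.aemeasurable hms,
        Measure.ae_prod_iff_ae_ae (p := fun p : (Fin k → E) × E =>
          LinearIndependent ℝ (Fin.snoc p.1 p.2 : Fin (k + 1) → E)) (hmp.measurable hms)]
      filter_upwards [hli] with x hx
      have hne : Submodule.span ℝ (Set.range x) ≠ ⊤ := by
        intro h
        have h3 := finrank_span_eq_card hx
        rw [h, finrank_top, Fintype.card_fin] at h3
        omega
      -- A proper subspace is Lebesgue null, hence Gaussian null.
      have h0 := stdGaussian_absolutelyContinuous E
        (Measure.addHaar_submodule volume (Submodule.span ℝ (Set.range x)) hne)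
      filter_upwards [measure_eq_zero_iff_ae_notMem.1 h0] with y hy
      exact linearIndependent_finSnoc.2 ⟨hx, hy⟩
    · have hwm : Measurable fun x : Fin (k + 1) → E => weight a (gram ℝ x) :=
        measurable_weight a continuous_gram
      rw [← hmp.map_eq, lintegral_map hwm hmp.measurable,
        lintegral_prod (fun p : (Fin k → E) × E =>
          weight a (gram ℝ (Fin.snoc p.1 p.2 : Fin (k + 1) → E)))
          (hwm.comp hmp.measurable).aemeasurable, Fin.prod_univ_castSucc]
      change _ = (∏ i : Fin k, radialMoment (finrank ℝ E - i) (a i.castSucc)) * _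
      rw [← hint, ← lintegral_mul_const _ (measurable_weight _ continuous_gram)]
      refine lintegral_congr_ae ?_
      filter_upwards [hli] with x hx
      simp_rw [weight_gram_snoc a hx]
      have hr : Measurable fun y => rejection x y := (rejection x).continuous.measurable
      rw [lintegral_const_mul _ (by fun_prop), lintegral_rejection hx]
      rfl

end Gram

end CompositeCosine

namespace CompositeCosine

open ProbabilityTheory Module
open scoped ENNReal InnerProductSpace

/-! ### Matrices with Gaussian columns and the QR decomposition. -/

section Columns

/-- The columns of a matrix, as vectors of Euclidean space. -/
noncomputable def columns {p m : ℕ} (A : Matrix (Fin p) (Fin m) ℝ) :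
    Fin m → EuclideanSpace ℝ (Fin p) :=
  fun j => WithLp.toLp 2 fun i => A i j

/-- The matrix with prescribed columns. -/
def ofColumns {p m : ℕ} (x : Fin m → EuclideanSpace ℝ (Fin p)) : Matrix (Fin p) (Fin m) ℝ :=
  of fun i j => x j i

theorem gram_eq_transpose_mul {p m : ℕ} (x : Fin m → EuclideanSpace ℝ (Fin p)) :
    gram ℝ x = (ofColumns x)ᵀ * ofColumns x := by
  ext i j
  rw [gram_apply, EuclideanSpace.inner_eq_star_dotProduct]
  simp [mul_apply, ofColumns, dotProduct, mul_comm]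

theorem transpose_mul_self_eq_gram {p m : ℕ} (A : Matrix (Fin p) (Fin m) ℝ) :
    Aᵀ * A = gram ℝ (columns A) :=
  (gram_eq_transpose_mul (columns A)).symm

theorem continuous_ofColumns {p m : ℕ} :
    Continuous (ofColumns : (Fin m → EuclideanSpace ℝ (Fin p)) → Matrix (Fin p) (Fin m) ℝ) :=
  continuous_matrix fun i j => by
    simp only [ofColumns, of_apply]
    fun_prop

/-- A matrix with orthonormal rows preserves the Gaussian integrals of functions of the columns. -/
theorem lintegral_ofColumns_mul {p n m : ℕ} (B : Matrix (Fin p) (Fin n) ℝ) (hB : B * Bᵀ = 1)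
    (a : Fin m → ℝ) :
    ∫⁻ x, weight a ((B * ofColumns x)ᵀ * (B * ofColumns x))
        ∂(Measure.pi fun _ : Fin m => stdGaussian (EuclideanSpace ℝ (Fin n))) =
      ∫⁻ x, weight a (gram ℝ x)
        ∂(Measure.pi fun _ : Fin m => stdGaussian (EuclideanSpace ℝ (Fin p))) := by
  let L : EuclideanSpace ℝ (Fin n) →L[ℝ] EuclideanSpace ℝ (Fin p) :=
    LinearMap.toContinuousLinearMap (toLpLin 2 2 B)
  have hLapp : ∀ x, L x = WithLp.toLp 2 (B *ᵥ x.ofLp) := fun x => rfl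
  have hL : (stdGaussian (EuclideanSpace ℝ (Fin n))).map L =
      stdGaussian (EuclideanSpace ℝ (Fin p)) := by
    apply map_stdGaussian_of_adjoint_isometry
    intro t
    have h1 : ContinuousLinearMap.adjoint L t = WithLp.toLp 2 (Bᵀ *ᵥ t.ofLp) := by
      refine ext_inner_left ℝ fun x => ?_
      rw [ContinuousLinearMap.adjoint_inner_right, hLapp,
        EuclideanSpace.inner_eq_star_dotProduct, EuclideanSpace.inner_eq_star_dotProduct]
      simp only [star_trivial]
      rw [dotProduct_mulVec, mulVec_transpose]
    -- `B Bᵀ = 1` says that `L L*` is the identity, so `L*` is isometric.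
    have h2 : L (ContinuousLinearMap.adjoint L t) = t := by
      rw [h1, hLapp]
      simp only [mulVec_mulVec, hB, one_mulVec, WithLp.toLp_ofLp]
    have h3 : ‖ContinuousLinearMap.adjoint L t‖ ^ 2 = ‖t‖ ^ 2 := by
      rw [← real_inner_self_eq_norm_sq, ContinuousLinearMap.adjoint_inner_left, h2,
        real_inner_self_eq_norm_sq]
    exact (sq_eq_sq₀ (norm_nonneg _) (norm_nonneg _)).1 h3
  have h1 : (Measure.pi fun _ : Fin m => stdGaussian (EuclideanSpace ℝ (Fin n))).map
      (fun x i => L (x i)) = Measure.pi fun _ : Fin m => stdGaussian (EuclideanSpace ℝ (Fin p)) := by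
    have : IsProbabilityMeasure ((stdGaussian (EuclideanSpace ℝ (Fin n))).map L) :=
      Measure.isProbabilityMeasure_map L.continuous.aemeasurable
    rw [Measure.pi_map_pi (fun _ => L.continuous.aemeasurable), hL]
  rw [← h1, lintegral_map (measurable_weight a continuous_gram) (by fun_prop)]
  refine lintegral_congr fun x => ?_
  rw [gram_eq_transpose_mul]
  rfl

theorem leadingMinor_gram_ne_zero {p m : ℕ} {x : Fin m → EuclideanSpace ℝ (Fin p)}
    (hx : LinearIndependent ℝ x) (k : ℕ) (hk : k ≤ m) : leadingMinor (gram ℝ x) k hk ≠ 0 := by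
  have h := det_gram_ne_zero_iff_linearIndependent.2 (hx.comp _ (Fin.castLE_injective hk))
  exact h

theorem minorRatio_gram_pos {p m : ℕ} {x : Fin m → EuclideanSpace ℝ (Fin p)}
    (hx : LinearIndependent ℝ x) (i : Fin m) : 0 < minorRatio (gram ℝ x) i :=
  (minorRatio_gram_nonneg x i).lt_of_ne'
    (div_ne_zero (leadingMinor_gram_ne_zero hx _ _) (leadingMinor_gram_ne_zero hx _ _))

/-- The `QR` decomposition of a rectangular matrix, with a full orthogonal factor. -/
theorem exists_orthogonal_mul_triangular {n m : ℕ} (h : m ≤ n)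
    (x : Fin m → EuclideanSpace ℝ (Fin n)) :
    ∃ (η : OGroup n) (T : Matrix (Fin m) (Fin m) ℝ), (∀ i j, j < i → T i j = 0) ∧
      ofColumns x = (frame h η).1 * T := by
  -- Padding by zeros to `n` vectors makes Gram–Schmidt return a full orthonormal basis.
  let f : Fin n → EuclideanSpace ℝ (Fin n) := fun j => if hj : (j : ℕ) < m then x ⟨j, hj⟩ else 0
  let b := InnerProductSpace.gramSchmidtOrthonormalBasis (𝕜 := ℝ) (by simp) f
  have hf : ∀ k : Fin m, f (Fin.castLE h k) = x k := fun k => by simp [f]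
  have htri : ∀ (j : Fin n) (k : Fin m), Fin.castLE h k < j → ⟪b j, x k⟫_ℝ = 0 := by
    intro j k hk
    rw [← hf k]
    exact InnerProductSpace.gramSchmidtOrthonormalBasis_inv_triangular _ f hk
  refine ⟨⟨of fun i j => b j i, ?_⟩, of fun j k => ⟪b (Fin.castLE h j), x k⟫_ℝ, ?_, ?_⟩
  · rw [mem_orthogonalGroup_iff']
    have h1 := gram_eq_transpose_mul (fun j => b j)
    have h2 : gram ℝ (fun j => b j) = 1 := gram_eq_one_iff_orthonormal.2 b.orthonormal
    rw [h2] at h1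
    exact h1.symm
  · intro i j hij
    exact htri _ _ (by simpa using hij)
  · ext i k
    have h1 := congrArg (fun y : EuclideanSpace ℝ (Fin n) => y i) (b.sum_repr' (x k))
    simp only [WithLp.ofLp_sum, Finset.sum_apply, WithLp.ofLp_smul, Pi.smul_apply,
      smul_eq_mul] at h1
    rw [mul_apply]
    simp only [ofColumns, of_apply, frame, submatrix_apply, id]
    rw [← h1]
    symm
    refine Fintype.sum_of_injective (Fin.castLE h) (Fin.castLE_injective h) _ _ ?_ ?_
    · intro j hj
      rw [htri j k, zero_mul]
      by_contra hcon
      exact hj ⟨⟨j, lt_of_le_of_lt (not_lt.1 hcon) k.isLt⟩, rfl⟩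
    · intro j
      rw [mul_comm]

end Columns

/-! ### Multiplicativity of the weight under triangular congruence. -/

section Triangular

variable {m : ℕ}

theorem leadingMinor_one (k : ℕ) (hk : k ≤ m) :
    leadingMinor (1 : Matrix (Fin m) (Fin m) ℝ) k hk = 1 := by
  rw [leadingMinor, submatrix_one _ (Fin.castLE_injective hk), det_one]

/-- For upper triangular `T` the leading blocks multiply, so the minor gains the squared determinant
of the block of `T`. Taking `r = 1` identifies that square. -/
theorem leadingMinor_transpose_mul_mul {T : Matrix (Fin m) (Fin m) ℝ}
    (hT : ∀ i j, j < i → T i j = 0) (r : Matrix (Fin m) (Fin m) ℝ) (k : ℕ) (hk : k ≤ m) :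
    leadingMinor (Tᵀ * r * T) k hk =
      leadingMinor r k hk * leadingMinor (Tᵀ * T) k hk := by
  have key : ∀ (A : Matrix (Fin m) (Fin m) ℝ) (f : Fin k → Fin m),
      (A * T).submatrix f (Fin.castLE hk) =
        A.submatrix f (Fin.castLE hk) * T.submatrix (Fin.castLE hk) (Fin.castLE hk) := by
    intro A f
    ext i j
    simp only [submatrix_apply, mul_apply]
    symm
    refine Fintype.sum_of_injective (Fin.castLE hk) (Fin.castLE_injective hk) _ _ ?_ ?_
    · intro l hl
      rw [hT l, mul_zero]
      by_contra hcon
      exact hl ⟨⟨l, lt_of_le_of_lt (not_lt.1 hcon) j.isLt⟩, rfl⟩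
    · intro l
      rfl
  have key2 : ∀ r : Matrix (Fin m) (Fin m) ℝ, leadingMinor (Tᵀ * r * T) k hk =
      leadingMinor r k hk * (T.submatrix (Fin.castLE hk) (Fin.castLE hk)).det ^ 2 := by
    intro r
    have h1 := key rᵀ (Fin.castLE hk)
    have h2 : (Tᵀ * r).submatrix (Fin.castLE hk) (Fin.castLE hk) =
        (T.submatrix (Fin.castLE hk) (Fin.castLE hk))ᵀ *
          r.submatrix (Fin.castLE hk) (Fin.castLE hk) := by
      rw [← transpose_inj, transpose_submatrix, transpose_mul, transpose_transpose, h1,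
        transpose_mul, transpose_transpose, transpose_submatrix]
    rw [leadingMinor, key, h2, det_mul, det_mul, det_transpose, leadingMinor]
    ring
  have h3 := key2 1
  rw [mul_one, leadingMinor_one, one_mul] at h3
  rw [key2, h3]

theorem minorRatio_transpose_mul_mul {T : Matrix (Fin m) (Fin m) ℝ}
    (hT : ∀ i j, j < i → T i j = 0) (r : Matrix (Fin m) (Fin m) ℝ) (i : Fin m) :
    minorRatio (Tᵀ * r * T) i = minorRatio r i * minorRatio (Tᵀ * T) i := by
  simp only [minorRatio, leadingMinor_transpose_mul_mul hT r]
  rw [mul_div_mul_comm]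

theorem weight_transpose_mul_mul {T : Matrix (Fin m) (Fin m) ℝ}
    (hT : ∀ i j, j < i → T i j = 0) (hpos : ∀ i, 0 < minorRatio (Tᵀ * T) i)
    (a : Fin m → ℝ) (r : Matrix (Fin m) (Fin m) ℝ) :
    weight a (Tᵀ * r * T) = weight a r * weight a (Tᵀ * T) := by
  rw [weight, weight, weight, ← Finset.prod_mul_distrib]
  refine Finset.prod_congr rfl fun i _ => ?_
  -- The exceptional case needs a base `0` against a base `∞`; both bases are finite.
  rw [minorRatio_transpose_mul_mul hT, ENNReal.ofReal_mul' (hpos i).le, ENNReal.mul_rpow_eq_ite,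
    if_neg]
  simp

end Triangular

/-! ### Haar measure of the orthogonal group. -/

section Haar

instance instSecondCountableTopologyMatrix (n m : ℕ) :
    SecondCountableTopology (Matrix (Fin n) (Fin m) ℝ) :=
  inferInstanceAs (SecondCountableTopology (Fin n → Fin m → ℝ))

instance instSecondCountableTopologyOGroup (n : ℕ) : SecondCountableTopology (OGroup n) :=
  TopologicalSpace.Subtype.secondCountableTopology _

instance instIsHaarMeasureHaarO (n : ℕ) : (haarO n).IsHaarMeasure := by
  unfold haarO
  infer_instance

instance instIsProbabilityMeasureHaarO (n : ℕ) : IsProbabilityMeasure (haarO n) :=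
  ⟨Measure.haarMeasure_self (K₀ := (⊤ : TopologicalSpace.PositiveCompacts (OGroup n)))⟩

/-- A right translate is again a left-invariant probability measure, so uniqueness of Haar measure
applies. -/
instance instIsMulRightInvariantHaarO (n : ℕ) : (haarO n).IsMulRightInvariant := by
  refine ⟨fun g => ?_⟩
  have h2 : IsProbabilityMeasure ((haarO n).map (· * g)) :=
    Measure.isProbabilityMeasure_map (measurable_mul_const g).aemeasurable
  have h := Measure.haarMeasure_unique ((haarO n).map (· * g)) ⊤
  rw [TopologicalSpace.PositiveCompacts.coe_top, measure_univ, one_smul] at h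
  exact h

end Haar

/-! ### The kernel matrix and the exact finiteness range of its mass. -/

section Stiefel

variable {n m : ℕ}

/-- The matrix `u' v v' u`. -/
def kernelGram (u v : Stiefel n m) : Matrix (Fin m) (Fin m) ℝ := u.1ᵀ * v.1 * v.1ᵀ * u.1

theorem kernelGram_eq_gram (u v : Stiefel n m) :
    kernelGram u v = gram ℝ (columns (v.1ᵀ * u.1)) := by
  rw [← transpose_mul_self_eq_gram, transpose_mul, transpose_transpose, kernelGram]
  simp only [Matrix.mul_assoc]

theorem minorRatio_kernelGram_nonneg (u v : Stiefel n m) (i : Fin m) :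
    0 ≤ minorRatio (kernelGram u v) i := by
  rw [kernelGram_eq_gram]
  exact minorRatio_gram_nonneg _ _

theorem minorRatio_kernelGram_le_one (u v : Stiefel n m) (i : Fin m) :
    minorRatio (kernelGram u v) i ≤ 1 := by
  have h1 : minorRatio (kernelGram u v) i ≤ kernelGram u v i i := by
    rw [kernelGram_eq_gram, gram_apply, real_inner_self_eq_norm_sq]
    exact minorRatio_gram_le _ _
  refine h1.trans ?_
  have hv := v.2
  have hu := u.2
  set P : Matrix (Fin n) (Fin m) ℝ := u.1 - v.1 * (v.1ᵀ * u.1) with hP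
  -- `P` is the part of `u` orthogonal to the range of `v`; nonnegative diagonal entries of `P'P`
  -- bound those of `u'vv'u` by `1`.
  have h2 : Pᵀ * P = 1 - kernelGram u v := by
    have h3 : v.1ᵀ * (v.1 * (v.1ᵀ * u.1)) = v.1ᵀ * u.1 := by
      rw [← Matrix.mul_assoc, hv, Matrix.one_mul]
    rw [hP, transpose_sub, transpose_mul, transpose_mul, transpose_transpose, kernelGram]
    simp only [Matrix.sub_mul, Matrix.mul_sub, Matrix.mul_assoc, h3, hu]
    abel
  have h3 := congrFun (congrFun h2 i) i
  rw [transpose_mul_self_eq_gram, gram_apply, real_inner_self_eq_norm_sq, Matrix.sub_apply,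
    one_apply_eq] at h3
  nlinarith [sq_nonneg ‖columns P i‖]

theorem weight_kernelGram_antitone {a b : Fin m → ℝ} (hab : ∀ i, a i ≤ b i)
    (u v : Stiefel n m) : weight b (kernelGram u v) ≤ weight a (kernelGram u v) :=
  Finset.prod_le_prod' fun i _ => ENNReal.rpow_le_rpow_of_exponent_ge
    (ENNReal.ofReal_le_one.2 (minorRatio_kernelGram_le_one u v i))
    (div_le_div_of_nonneg_right (hab i) two_pos.le)

theorem mul_frame (h : m ≤ n) (γ η : OGroup n) :
    γ.1 * (frame h η).1 = (frame h (γ * η)).1 := by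
  ext i j
  simp [frame, mul_apply]

theorem continuous_kernelGram :
    Continuous fun p : Stiefel n m × Stiefel n m => kernelGram p.1 p.2 := by
  unfold kernelGram
  fun_prop

/-- The integral of the kernel with real exponents over the orthogonal group. -/
noncomputable def kernelMass (h : m ≤ n) (a : Fin m → ℝ) : ℝ≥0∞ :=
  ∫⁻ γ, weight a (kernelGram (frame h γ) (frame h 1)) ∂(haarO n)

theorem measurable_weight_kernelGram_frame (h : m ≤ n) (a : Fin m → ℝ) :
    Measurable fun γ : OGroup n => weight a (kernelGram (frame h γ) (frame h 1)) := by
  refine measurable_weight a ?_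
  have h1 := continuous_frame (m := m) h
  unfold kernelGram
  fun_prop

/-- The triangular QR factor of `x` leaves the integral as the weight of `x'x`; right invariance
absorbs the orthogonal one. -/
theorem lintegral_weight_orbit (h : m ≤ n) (a : Fin m → ℝ)
    {x : Fin m → EuclideanSpace ℝ (Fin n)} (hx : LinearIndependent ℝ x) :
    ∫⁻ γ, weight a (((frame h 1).1ᵀ * γ.1 * ofColumns x)ᵀ *
        ((frame h 1).1ᵀ * γ.1 * ofColumns x)) ∂(haarO n) =
      kernelMass h a * weight a (gram ℝ x) := by
  obtain ⟨η, T, hT, hxT⟩ := exists_orthogonal_mul_triangular h x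
  have hgram : gram ℝ x = Tᵀ * T := by
    rw [gram_eq_transpose_mul, hxT, transpose_mul, Matrix.mul_assoc, ← Matrix.mul_assoc _ _ T,
      (frame h η).2, Matrix.one_mul]
  have hpos : ∀ i, 0 < minorRatio (Tᵀ * T) i := fun i => by
    rw [← hgram]
    exact minorRatio_gram_pos hx i
  have h1 : ∀ γ : OGroup n, ((frame h 1).1ᵀ * γ.1 * ofColumns x)ᵀ *
      ((frame h 1).1ᵀ * γ.1 * ofColumns x) =
      Tᵀ * kernelGram (frame h (γ * η)) (frame h 1) * T := by
    intro γ
    rw [hxT, kernelGram, ← mul_frame h γ η]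
    simp only [transpose_mul, transpose_transpose, Matrix.mul_assoc]
  have h2 : ∀ γ : OGroup n, weight a (((frame h 1).1ᵀ * γ.1 * ofColumns x)ᵀ *
      ((frame h 1).1ᵀ * γ.1 * ofColumns x)) =
      weight a (kernelGram (frame h (γ * η)) (frame h 1)) * weight a (Tᵀ * T) := fun γ => by
    rw [h1, weight_transpose_mul_mul hT hpos]
  rw [hgram, lintegral_congr h2, kernelMass]
  have hm : Measurable fun γ => weight a (kernelGram (frame h γ) (frame h 1)) :=
    measurable_weight_kernelGram_frame h a
  have hm' : Measurable fun γ => weight a (kernelGram (frame h (γ * η)) (frame h 1)) :=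
    hm.comp (measurable_mul_const η)
  rw [lintegral_mul_const _ hm', lintegral_mul_right_eq_self (fun γ => weight a (kernelGram (frame h γ) (frame h 1))) η]

/-- The product formula relating the mass of the kernel to moments of Gaussian vectors. -/
theorem kernelMass_mul_prod_radialMoment (h : m ≤ n) (a : Fin m → ℝ) :
    kernelMass h a * ∏ i : Fin m, radialMoment (n - i) (a i) =
      ∏ i : Fin m, radialMoment (m - i) (a i) := by
  obtain ⟨hli, hn⟩ := ae_linearIndependent_and_lintegral_weight_gram
    (E := EuclideanSpace ℝ (Fin n)) (by simpa using h) a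
  obtain ⟨-, hm⟩ := ae_linearIndependent_and_lintegral_weight_gram
    (E := EuclideanSpace ℝ (Fin m)) (by simp) a
  simp only [finrank_euclideanSpace_fin] at hn hm
  have hrot : ∀ γ : OGroup n, ∫⁻ x, weight a (((frame h 1).1ᵀ * γ.1 * ofColumns x)ᵀ *
        ((frame h 1).1ᵀ * γ.1 * ofColumns x))
        ∂(Measure.pi fun _ : Fin m => stdGaussian (EuclideanSpace ℝ (Fin n))) =
      ∏ i : Fin m, radialMoment (m - i) (a i) := by
    intro γ
    rw [← hm]
    refine lintegral_ofColumns_mul ((frame h 1).1ᵀ * γ.1) ?_ a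
    have h1 : γ.1 * γ.1ᵀ = 1 := (mem_orthogonalGroup_iff _ _).1 γ.2
    rw [transpose_mul, transpose_transpose, Matrix.mul_assoc, ← Matrix.mul_assoc γ.1, h1,
      Matrix.one_mul, (frame h 1).2]
  have hmeas : Measurable fun p : (Fin m → EuclideanSpace ℝ (Fin n)) × OGroup n =>
      weight a (((frame h 1).1ᵀ * p.2.1 * ofColumns p.1)ᵀ *
        ((frame h 1).1ᵀ * p.2.1 * ofColumns p.1)) := by
    refine measurable_weight a ?_
    have h1 := continuous_ofColumns (p := n) (m := m)
    fun_prop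
  have hav : ∫⁻ _ : OGroup n, (∏ i : Fin m, radialMoment (m - i) (a i)) ∂(haarO n) =
      ∏ i : Fin m, radialMoment (m - i) (a i) := by simp
  rw [← hav, ← hn, ← lintegral_const_mul _ (measurable_weight a continuous_gram)]
  rw [lintegral_congr fun γ => (hrot γ).symm]
  -- For fixed `γ` the integral over `x` is the moment product of `hrot`; after the swap, the
  -- integral over `γ` is `lintegral_weight_orbit`.
  rw [lintegral_lintegral_swap (f := fun (γ : OGroup n) x =>
    weight a (((frame h 1).1ᵀ * γ.1 * ofColumns x)ᵀ * ((frame h 1).1ᵀ * γ.1 * ofColumns x)))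
    (hmeas.comp measurable_swap).aemeasurable]
  refine lintegral_congr_ae ?_
  filter_upwards [hli] with x hx
  exact (lintegral_weight_orbit h a hx).symm

theorem kernelMass_antitone (h : m ≤ n) {a b : Fin m → ℝ} (hab : ∀ i, a i ≤ b i) :
    kernelMass h b ≤ kernelMass h a :=
  lintegral_mono fun _ => weight_kernelGram_antitone hab _ _

theorem kernelMass_lt_top_iff (h : m < n) (a : Fin m → ℝ) :
    kernelMass h.le a < ∞ ↔ ∀ i : Fin m, (i : ℝ) - m < a i := by
  have hcast : ∀ i : Fin m, ((m - i : ℕ) : ℝ) = m - i := fun i => Nat.cast_sub i.isLt.le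
  have hcast' : ∀ i : Fin m, ((n - i : ℕ) : ℝ) = n - i := fun i =>
    Nat.cast_sub (i.isLt.le.trans h.le)
  have hmn : (m : ℝ) < n := by exact_mod_cast h
  constructor
  · intro hfin
    by_contra! ⟨i, hi⟩
    -- If some `a j` is at most `j - n`, both sides of the product formula are infinite and say
    -- nothing. Raising the exponents keeps the mass finite and makes all `n`-side moments finite,
    -- while the `m`-side moment of index `i` still diverges.
    set b : Fin m → ℝ := fun j => max (a j) (j - m) with hb
    have h1 : kernelMass h.le b < ∞ :=
      (kernelMass_antitone h.le fun j => le_max_left _ _).trans_lt hfin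
    have h2 : ∏ j : Fin m, radialMoment (n - j) (b j) < ∞ := by
      refine ENNReal.prod_lt_top fun j _ => (radialMoment_lt_top_iff (by omega) _).2 ?_
      have : (j : ℝ) - m ≤ b j := le_max_right _ _
      rw [hcast']
      linarith
    have h3 := ENNReal.mul_lt_top h1 h2
    rw [kernelMass_mul_prod_radialMoment, ← Finset.prod_erase_mul _ _ (Finset.mem_univ i)] at h3
    have h4 : radialMoment (m - i) (b i) = ∞ := by
      rw [← not_lt_top_iff, radialMoment_lt_top_iff (by omega), hcast, hb]
      simp only [max_eq_right hi]
      linarith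
    rw [h4, ENNReal.mul_top] at h3
    · exact lt_irrefl _ h3
    · exact Finset.prod_ne_zero_iff.2 fun j _ => (radialMoment_pos (by omega) _).ne'
  · intro ha
    have h1 : ∏ j : Fin m, radialMoment (m - j) (a j) < ∞ := by
      refine ENNReal.prod_lt_top fun j _ => (radialMoment_lt_top_iff (by omega) _).2 ?_
      rw [hcast]
      linarith [ha j]
    have h2 : ∏ j : Fin m, radialMoment (n - j) (a j) ≠ 0 :=
      Finset.prod_ne_zero_iff.2 fun j _ => (radialMoment_pos (by omega) _).ne'
    rw [← kernelMass_mul_prod_radialMoment h.le] at h1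
    by_contra hcon
    rw [not_lt_top_iff] at hcon
    rw [hcon, ENNReal.top_mul h2] at h1
    exact lt_irrefl _ h1

end Stiefel

end CompositeCosine

namespace CompositeCosine

open scoped ENNReal

/-! ### Invariance and Tonelli on the Stiefel manifold. -/

section Measure

variable {n m : ℕ}

instance instSecondCountableTopologyStiefel (n m : ℕ) : SecondCountableTopology (Stiefel n m) :=
  TopologicalSpace.Subtype.secondCountableTopology _

theorem sphereArea_pos (i : ℕ) : 0 < sphereArea i := by
  have h : 0 < Real.Gamma (((i : ℝ) + 1) / 2) := Real.Gamma_pos_of_pos (by positivity)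
  unfold sphereArea
  positivity

theorem stiefelVolume_pos (n m : ℕ) : 0 < stiefelVolume n m :=
  Finset.prod_pos fun _ _ => sphereArea_pos _

theorem lintegral_stiefelMeasure (h : m ≤ n) {g : Stiefel n m → ℝ≥0∞} (hg : Measurable g) :
    ∫⁻ v, g v ∂(stiefelMeasure h) =
      ENNReal.ofReal (stiefelVolume n m) * ∫⁻ γ, g (frame h γ) ∂(haarO n) := by
  rw [stiefelMeasure, lintegral_smul_measure, lintegral_map hg (continuous_frame h).measurable,
    smul_eq_mul]

instance instIsFiniteMeasureStiefel (h : m ≤ n) : IsFiniteMeasure (stiefelMeasure h) := by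
  refine ⟨?_⟩
  rw [← lintegral_one, lintegral_stiefelMeasure h measurable_const]
  simp

/-- The point is found among images of orthogonal matrices, so surjectivity of `frame` is not
needed. -/
theorem exists_frame_of_ae {h : m ≤ n} {p : Stiefel n m → Prop}
    (hp : ∀ᵐ u ∂(stiefelMeasure h), p u) : ∃ γ : OGroup n, p (frame h γ) := by
  rw [stiefelMeasure, Measure.ae_ennreal_smul_measure_iff
    (ENNReal.ofReal_pos.2 (stiefelVolume_pos n m)).ne'] at hp
  exact (ae_of_ae_map (continuous_frame h).measurable.aemeasurable hp).exists

theorem continuous_kernelGram_left (v : Stiefel n m) : Continuous fun u => kernelGram u v := by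
  unfold kernelGram
  fun_prop

theorem continuous_kernelGram_right (u : Stiefel n m) : Continuous fun v => kernelGram u v := by
  unfold kernelGram
  fun_prop

theorem kernelGram_frame_mul (h : m ≤ n) (g γ η : OGroup n) :
    kernelGram (frame h (g * γ)) (frame h (g * η)) = kernelGram (frame h γ) (frame h η) := by
  have hg : g.1ᵀ * g.1 = 1 := (mem_orthogonalGroup_iff' _ _).1 g.2
  have hg' : ∀ A : Matrix (Fin n) (Fin m) ℝ, g.1ᵀ * (g.1 * A) = A := fun A => by
    rw [← Matrix.mul_assoc, hg, Matrix.one_mul]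
  rw [kernelGram, kernelGram, ← mul_frame, ← mul_frame]
  simp only [transpose_mul, Matrix.mul_assoc, hg']

/-- Every frame has the same range as the initial frame of an orthogonal matrix. -/
theorem exists_kernelGram_eq_frame (h : m ≤ n) (v : Stiefel n m) :
    ∃ η : OGroup n, ∀ u, kernelGram u v = kernelGram u (frame h η) := by
  obtain ⟨η, T, -, hT⟩ := exists_orthogonal_mul_triangular h (columns v.1)
  have hv : v.1 = (frame h η).1 * T := hT
  -- `T` is orthogonal, so it cancels in `vv'`, the only way `v` enters the kernel matrix.
  have hTT : Tᵀ * T = 1 := by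
    have h1 := v.2
    rw [hv, transpose_mul, Matrix.mul_assoc, ← Matrix.mul_assoc _ _ T, (frame h η).2,
      Matrix.one_mul] at h1
    exact h1
  have hTT' : ∀ A : Matrix (Fin m) (Fin m) ℝ, T * (Tᵀ * A) = A := fun A => by
    rw [← Matrix.mul_assoc, mul_eq_one_comm.1 hTT, Matrix.one_mul]
  refine ⟨η, fun u => ?_⟩
  rw [kernelGram, kernelGram, hv, transpose_mul]
  simp only [Matrix.mul_assoc, hTT']

theorem lintegral_weight_frame_left (h : m ≤ n) (a : Fin m → ℝ) (η : OGroup n) :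
    ∫⁻ γ, weight a (kernelGram (frame h γ) (frame h η)) ∂(haarO n) = kernelMass h a := by
  rw [kernelMass, ← lintegral_mul_left_eq_self
    (fun γ => weight a (kernelGram (frame h γ) (frame h η))) η]
  refine lintegral_congr fun γ => ?_
  rw [← kernelGram_frame_mul h η γ 1, mul_one]

theorem measurable_weight_kernelGram (a : Fin m → ℝ) :
    Measurable fun p : Stiefel n m × Stiefel n m => weight a (kernelGram p.1 p.2) :=
  measurable_weight a continuous_kernelGram

/-- The two frames play different roles in `u'vv'u`, so symmetry is not available. By left
invariance the integral is the same for every `γ`; averaging over `γ` and swapping reduces to the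
other variable. -/
theorem lintegral_weight_frame_right (h : m ≤ n) (a : Fin m → ℝ) (γ : OGroup n) :
    ∫⁻ η, weight a (kernelGram (frame h γ) (frame h η)) ∂(haarO n) = kernelMass h a := by
  have h1 : ∀ γ' : OGroup n, ∫⁻ η, weight a (kernelGram (frame h γ') (frame h η)) ∂(haarO n) =
      ∫⁻ η, weight a (kernelGram (frame h γ) (frame h η)) ∂(haarO n) := by
    intro γ'
    rw [← lintegral_mul_left_eq_self
      (fun η => weight a (kernelGram (frame h γ') (frame h η))) (γ' * γ⁻¹)]
    refine lintegral_congr fun η => ?_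
    rw [← kernelGram_frame_mul h (γ' * γ⁻¹) γ η, inv_mul_cancel_right]
  have hm : Measurable fun p : OGroup n × OGroup n =>
      weight a (kernelGram (frame h p.1) (frame h p.2)) := by
    refine measurable_weight a ?_
    have h2 := continuous_frame (m := m) h
    unfold kernelGram
    fun_prop
  calc ∫⁻ η, weight a (kernelGram (frame h γ) (frame h η)) ∂(haarO n)
      = ∫⁻ γ', ∫⁻ η, weight a (kernelGram (frame h γ') (frame h η)) ∂(haarO n) ∂(haarO n) := by
        rw [lintegral_congr h1]
        simp
    _ = ∫⁻ η, ∫⁻ γ', weight a (kernelGram (frame h γ') (frame h η)) ∂(haarO n) ∂(haarO n) :=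
        lintegral_lintegral_swap hm.aemeasurable
    _ = kernelMass h a := by
        rw [lintegral_congr (lintegral_weight_frame_left h a)]
        simp

theorem lintegral_weight_left (h : m ≤ n) (a : Fin m → ℝ) (v : Stiefel n m) :
    ∫⁻ u, weight a (kernelGram u v) ∂(stiefelMeasure h) =
      ENNReal.ofReal (stiefelVolume n m) * kernelMass h a := by
  obtain ⟨η, hη⟩ := exists_kernelGram_eq_frame h v
  rw [lintegral_stiefelMeasure h (measurable_weight a (continuous_kernelGram_left v))]
  simp_rw [hη]
  rw [lintegral_weight_frame_left]

theorem lintegral_weight_right (h : m ≤ n) (a : Fin m → ℝ) (γ : OGroup n) :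
    ∫⁻ v, weight a (kernelGram (frame h γ) v) ∂(stiefelMeasure h) =
      ENNReal.ofReal (stiefelVolume n m) * kernelMass h a := by
  rw [lintegral_stiefelMeasure h (measurable_weight a (continuous_kernelGram_right _)),
    lintegral_weight_frame_right]

theorem lintegral_lintegral_mul_weight (h : m ≤ n) (a : Fin m → ℝ) {f : Stiefel n m → ℂ}
    (hf : AEStronglyMeasurable f (stiefelMeasure h)) :
    ∫⁻ u, ∫⁻ v, ‖f v‖ₑ * weight a (kernelGram u v) ∂(stiefelMeasure h) ∂(stiefelMeasure h) =
      ENNReal.ofReal (stiefelVolume n m) * kernelMass h a *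
        ∫⁻ v, ‖f v‖ₑ ∂(stiefelMeasure h) := by
  rw [lintegral_lintegral_swap, ← lintegral_const_mul'' _ hf.enorm]
  · refine lintegral_congr fun v => ?_
    rw [lintegral_const_mul _ (measurable_weight a (continuous_kernelGram_left v)),
      lintegral_weight_left, mul_comm]
  · exact (hf.comp_snd (μ := stiefelMeasure h)).enorm.mul
      (measurable_weight_kernelGram a).aemeasurable

theorem ae_lintegral_mul_weight_lt_top (h : m < n) {a : Fin m → ℝ}
    (ha : ∀ i : Fin m, (i : ℝ) - m < a i) {f : Stiefel n m → ℂ}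
    (hf : Integrable f (stiefelMeasure h.le)) :
    ∀ᵐ u ∂(stiefelMeasure h.le),
      ∫⁻ v, ‖f v‖ₑ * weight a (kernelGram u v) ∂(stiefelMeasure h.le) < ∞ := by
  have h1 : ∫⁻ u, ∫⁻ v, ‖f v‖ₑ * weight a (kernelGram u v)
      ∂(stiefelMeasure h.le) ∂(stiefelMeasure h.le) ≠ ∞ := by
    rw [lintegral_lintegral_mul_weight h.le a hf.1]
    exact ENNReal.mul_ne_top (ENNReal.mul_ne_top ENNReal.ofReal_ne_top
      ((kernelMass_lt_top_iff h a).2 ha).ne) hf.2.ne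
  refine ae_lt_top' ?_ h1
  exact ((hf.1.comp_snd (μ := stiefelMeasure h.le)).enorm.mul
    (measurable_weight_kernelGram a).aemeasurable).lintegral_prod_right'

/-- The minors of `u' v v' u` are almost surely positive. -/
theorem ae_ae_minorRatio_pos (h : m < n) :
    ∀ᵐ u ∂(stiefelMeasure h.le), ∀ᵐ v ∂(stiefelMeasure h.le), ∀ i : Fin m,
      0 < minorRatio (kernelGram u v) i := by
  -- The exponent `-1/2` is admissible because `i - m ≤ -1`; being negative, it makes the weight
  -- infinite wherever a ratio vanishes, the other factors being at least `1`.
  have ha : ∀ i : Fin m, (i : ℝ) - m < (fun _ : Fin m => -(1 / 2 : ℝ)) i := fun i => by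
    have : (i : ℝ) + 1 ≤ m := by exact_mod_cast i.isLt
    simp only
    linarith
  filter_upwards [ae_lintegral_mul_weight_lt_top h ha (f := fun _ => 1)
    (integrable_const _)] with u hu
  simp only [enorm_one, one_mul] at hu
  filter_upwards [ae_lt_top (measurable_weight _ (continuous_kernelGram_right u)) hu.ne]
    with v hv i
  refine (minorRatio_kernelGram_nonneg u v i).lt_of_ne' fun h0 => ?_
  have hle : ∀ j, 1 ≤ ENNReal.ofReal (minorRatio (kernelGram u v) j) ^ (-(1 / 2 : ℝ) / 2) :=
    fun j => by
      simpa using ENNReal.rpow_le_rpow_of_exponent_ge (y := 0) (z := -(1 / 2 : ℝ) / 2)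
        (ENNReal.ofReal_le_one.2 (minorRatio_kernelGram_le_one u v j)) (by norm_num)
  have h1 : ENNReal.ofReal (minorRatio (kernelGram u v) i) ^ (-(1 / 2 : ℝ) / 2) ≤
      weight (fun _ => -(1 / 2 : ℝ)) (kernelGram u v) :=
    Finset.single_le_prod' (f := fun j =>
      ENNReal.ofReal (minorRatio (kernelGram u v) j) ^ (-(1 / 2 : ℝ) / 2))
      (fun j _ => hle j) (Finset.mem_univ i)
  rw [h0, ENNReal.ofReal_zero, ENNReal.zero_rpow_of_neg (by norm_num)] at h1
  exact absurd hv (not_lt.2 h1)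

end Measure

/-! ### The complex kernel and the equivalence of convergence with the domain. -/

section Kernel

variable {n m : ℕ}

theorem kernel_eq_prod (lam : Fin m → ℂ) (u v : Stiefel n m) :
    kernel lam u v = ∏ i, ((minorRatio (kernelGram u v) i : ℝ) : ℂ) ^ (lam i / 2) := rfl

/-- Equality can fail only at `x = 0`, where the complex power is `0` for `z ≠ 0` but the right side
may be `1` or `∞`. -/
theorem enorm_ofReal_cpow_le {x : ℝ} (hx : 0 ≤ x) (z : ℂ) :
    ‖(x : ℂ) ^ (z / 2)‖ₑ ≤ ENNReal.ofReal x ^ (z.re / 2) := by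
  rcases hx.eq_or_lt with rfl | hx
  · rcases eq_or_ne z 0 with rfl | hz
    · simp
    · rw [Complex.ofReal_zero, Complex.zero_cpow (by simpa using hz)]
      simp
  · rw [← ofReal_norm, Complex.norm_cpow_eq_rpow_re_of_pos hx,
      ENNReal.ofReal_rpow_of_pos hx]
    simp

theorem enorm_ofReal_cpow {x : ℝ} (hx : 0 < x) (z : ℂ) :
    ‖(x : ℂ) ^ (z / 2)‖ₑ = ENNReal.ofReal x ^ (z.re / 2) := by
  rw [← ofReal_norm, Complex.norm_cpow_eq_rpow_re_of_pos hx,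
    ENNReal.ofReal_rpow_of_pos hx]
  simp

theorem enorm_finset_prod {ι : Type*} (s : Finset ι) (g : ι → ℂ) :
    ‖∏ i ∈ s, g i‖ₑ = ∏ i ∈ s, ‖g i‖ₑ := by
  simp_rw [← ofReal_norm, norm_prod]
  exact ENNReal.ofReal_prod_of_nonneg fun _ _ => norm_nonneg _

theorem enorm_kernel_le (lam : Fin m → ℂ) (u v : Stiefel n m) :
    ‖kernel lam u v‖ₑ ≤ weight (fun i => (lam i).re) (kernelGram u v) := by
  rw [kernel_eq_prod, enorm_finset_prod]
  exact Finset.prod_le_prod' fun i _ => enorm_ofReal_cpow_le (minorRatio_kernelGram_nonneg u v i) _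

theorem enorm_kernel (lam : Fin m → ℂ) {u v : Stiefel n m}
    (hpos : ∀ i, 0 < minorRatio (kernelGram u v) i) :
    ‖kernel lam u v‖ₑ = weight (fun i => (lam i).re) (kernelGram u v) := by
  rw [kernel_eq_prod, enorm_finset_prod]
  exact Finset.prod_congr rfl fun i _ => enorm_ofReal_cpow (hpos i) _

theorem measurable_kernel (lam : Fin m → ℂ) :
    Measurable fun p : Stiefel n m × Stiefel n m => kernel lam p.1 p.2 := by
  simp_rw [kernel_eq_prod]
  exact Finset.measurable_prod _ fun i _ =>
    (Complex.measurable_ofReal.comp (measurable_minorRatio continuous_kernelGram i)).pow_const _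

theorem measurable_kernel_right (lam : Fin m → ℂ) (u : Stiefel n m) :
    Measurable fun v => kernel lam u v := by
  simp_rw [kernel_eq_prod]
  exact Finset.measurable_prod _ fun i _ => (Complex.measurable_ofReal.comp
    (measurable_minorRatio (continuous_kernelGram_right u) i)).pow_const _

theorem convergesAt_of_lintegral_lt_top {h : m ≤ n} {lam : Fin m → ℂ} {a : Fin m → ℝ}
    (ha : ∀ i, a i ≤ (lam i).re) {f : Stiefel n m → ℂ}
    (hf : AEStronglyMeasurable f (stiefelMeasure h)) {u : Stiefel n m}
    (hu : ∫⁻ v, ‖f v‖ₑ * weight a (kernelGram u v) ∂(stiefelMeasure h) < ∞) :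
    ConvergesAt h lam f u := by
  refine ⟨hf.mul (measurable_kernel_right lam u).aestronglyMeasurable, ?_⟩
  refine (lintegral_mono fun v => ?_).trans_lt hu
  rw [enorm_mul]
  exact mul_le_mul_right ((enorm_kernel_le lam u v).trans (weight_kernelGram_antitone ha u v)) _

theorem mem_domain_iff (lam : Fin m → ℂ) :
    lam ∈ domain m ↔ ∀ i : Fin m, (i : ℝ) - m < (lam i).re := by
  refine forall_congr' fun i => ?_
  rw [show (i : ℝ) + 1 - m - 1 = i - m by ring]

theorem ae_convergesAt_iff_mem_domain (h : m < n) (lam : Fin m → ℂ) :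
    (∀ f : Stiefel n m → ℂ, Integrable f (stiefelMeasure h.le) →
      ∀ᵐ u ∂(stiefelMeasure h.le), ConvergesAt h.le lam f u) ↔ lam ∈ domain m := by
  rw [mem_domain_iff]
  constructor
  · intro H
    obtain ⟨γ, hγ, hpos⟩ := exists_frame_of_ae ((H (fun _ => 1) (integrable_const _)).and
      (ae_ae_minorRatio_pos h))
    rw [← kernelMass_lt_top_iff h]
    have h1 := hγ.2
    rw [HasFiniteIntegral] at h1
    have h2 : ∫⁻ v, ‖(1 : ℂ) * kernel lam (frame h.le γ) v‖ₑ ∂(stiefelMeasure h.le) =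
        ∫⁻ v, weight (fun i => (lam i).re) (kernelGram (frame h.le γ) v)
          ∂(stiefelMeasure h.le) := by
      refine lintegral_congr_ae ?_
      filter_upwards [hpos] with v hv
      rw [one_mul, enorm_kernel lam hv]
    rw [h2, lintegral_weight_right] at h1
    by_contra hcon
    rw [not_lt_top_iff] at hcon
    rw [hcon, ENNReal.mul_top (ENNReal.ofReal_pos.2 (stiefelVolume_pos n m)).ne'] at h1
    exact lt_irrefl _ h1
  · intro hlam f hf
    filter_upwards [ae_lintegral_mul_weight_lt_top h hlam hf] with u hu
    exact convergesAt_of_lintegral_lt_top (fun _ => le_rfl) hf.1 hu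

end Kernel

/-! ### Boundedness on `L¹`. -/

section Operator

variable {n m : ℕ}

theorem lintegral_lintegral_enorm_mul_kernel_le (h : m ≤ n) (lam : Fin m → ℂ)
    {f : Stiefel n m → ℂ} (hf : AEStronglyMeasurable f (stiefelMeasure h)) :
    ∫⁻ u, ∫⁻ v, ‖f v * kernel lam u v‖ₑ ∂(stiefelMeasure h) ∂(stiefelMeasure h) ≤
      ENNReal.ofReal (stiefelVolume n m) * kernelMass h (fun i => (lam i).re) *
        ∫⁻ v, ‖f v‖ₑ ∂(stiefelMeasure h) := by
  rw [← lintegral_lintegral_mul_weight h _ hf]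
  refine lintegral_mono fun u => lintegral_mono fun v => ?_
  rw [enorm_mul]
  exact mul_le_mul_right (enorm_kernel_le lam u v) _

theorem integrable_cosineTransform (h : m < n) {lam : Fin m → ℂ} (hlam : lam ∈ domain m)
    {f : Stiefel n m → ℂ} (hf : Integrable f (stiefelMeasure h.le)) :
    Integrable (cosineTransform h.le lam f) (stiefelMeasure h.le) := by
  have hm : AEStronglyMeasurable (fun p : Stiefel n m × Stiefel n m => f p.2 * kernel lam p.1 p.2)
      ((stiefelMeasure h.le).prod (stiefelMeasure h.le)) :=
    hf.1.comp_snd.mul (measurable_kernel lam).aestronglyMeasurable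
  have hi : Integrable (fun p : Stiefel n m × Stiefel n m => f p.2 * kernel lam p.1 p.2)
      ((stiefelMeasure h.le).prod (stiefelMeasure h.le)) := by
    refine ⟨hm, ?_⟩
    rw [HasFiniteIntegral, lintegral_prod _ hm.enorm]
    refine (lintegral_lintegral_enorm_mul_kernel_le h.le lam hf.1).trans_lt ?_
    exact ENNReal.mul_lt_top (ENNReal.mul_lt_top ENNReal.ofReal_lt_top
      ((kernelMass_lt_top_iff h _).2 ((mem_domain_iff lam).1 hlam))) hf.2
  exact hi.integral_prod_left

theorem lintegral_enorm_cosineTransform_le (h : m ≤ n) (lam : Fin m → ℂ)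
    {f : Stiefel n m → ℂ} (hf : AEStronglyMeasurable f (stiefelMeasure h)) :
    ∫⁻ u, ‖cosineTransform h lam f u‖ₑ ∂(stiefelMeasure h) ≤
      ENNReal.ofReal (stiefelVolume n m) * kernelMass h (fun i => (lam i).re) *
        ∫⁻ v, ‖f v‖ₑ ∂(stiefelMeasure h) :=
  (lintegral_mono fun _ => enorm_integral_le_lintegral_enorm _).trans
    (lintegral_lintegral_enorm_mul_kernel_le h lam hf)

theorem cosineTransform_congr (h : m ≤ n) (lam : Fin m → ℂ) {f g : Stiefel n m → ℂ}
    (hfg : f =ᵐ[stiefelMeasure h] g) : cosineTransform h lam f = cosineTransform h lam g := by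
  ext u
  refine integral_congr_ae ?_
  filter_upwards [hfg] with v hv
  rw [hv]

theorem exists_continuousLinearMap_eq_cosineTransform (h : m < n) {lam : Fin m → ℂ}
    (hlam : lam ∈ domain m) :
    ∃ L : Lp ℂ 1 (stiefelMeasure (n := n) (m := m) h.le) →L[ℂ]
        Lp ℂ 1 (stiefelMeasure (n := n) (m := m) h.le),
      ∀ f : Lp ℂ 1 (stiefelMeasure (n := n) (m := m) h.le),
        (L f : Stiefel n m → ℂ) =ᵐ[stiefelMeasure h.le] cosineTransform h.le lam f := by
  have hint : ∀ f : Lp ℂ 1 (stiefelMeasure (n := n) (m := m) h.le),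
      Integrable (cosineTransform h.le lam f) (stiefelMeasure h.le) := fun f =>
    integrable_cosineTransform h hlam (L1.integrable_coeFn f)
  let T : Lp ℂ 1 (stiefelMeasure (n := n) (m := m) h.le) →ₗ[ℂ]
      Lp ℂ 1 (stiefelMeasure (n := n) (m := m) h.le) :=
    { toFun := fun f => (hint f).toL1 _
      map_add' := fun f g => by
        refine Lp.ext ?_
        -- Additivity at `u` needs both integrals to converge there, hence the two almost everywhere
        -- convergence statements.
        filter_upwards [(hint (f + g)).coeFn_toL1, (hint f).coeFn_toL1, (hint g).coeFn_toL1,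
          Lp.coeFn_add ((hint f).toL1 _) ((hint g).toL1 _),
          (ae_convergesAt_iff_mem_domain h lam).2 hlam f (L1.integrable_coeFn f),
          (ae_convergesAt_iff_mem_domain h lam).2 hlam g (L1.integrable_coeFn g)]
          with u h1 h2 h3 h4 h5 h6
        rw [h1, h4, Pi.add_apply, h2, h3, cosineTransform_congr h.le lam (Lp.coeFn_add f g)]
        simp only [cosineTransform, Pi.add_apply, add_mul]
        exact integral_add h5 h6
      map_smul' := fun c f => by
        refine Lp.ext ?_
        filter_upwards [(hint (c • f)).coeFn_toL1, (hint f).coeFn_toL1,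
          Lp.coeFn_smul c ((hint f).toL1 _)] with u h1 h2 h3
        rw [RingHom.id_apply, h1, h3, Pi.smul_apply, h2,
          cosineTransform_congr h.le lam (Lp.coeFn_smul c f)]
        simp only [cosineTransform, Pi.smul_apply, smul_eq_mul, mul_assoc]
        exact integral_const_mul _ _ }
  set C : ℝ≥0∞ := ENNReal.ofReal (stiefelVolume n m) * kernelMass h.le (fun i => (lam i).re)
    with hC
  have hCtop : C ≠ ∞ := ENNReal.mul_ne_top ENNReal.ofReal_ne_top
    ((kernelMass_lt_top_iff h _).2 ((mem_domain_iff lam).1 hlam)).ne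
  refine ⟨T.mkContinuous C.toReal fun f => ?_, fun f => (hint f).coeFn_toL1⟩
  change ‖(hint f).toL1 _‖ ≤ _
  have hf := L1.integrable_coeFn f
  rw [Integrable.norm_toL1_eq_lintegral_enorm, L1.norm_def, ← ENNReal.toReal_mul]
  exact ENNReal.toReal_mono (ENNReal.mul_ne_top hCtop hf.2.ne)
    (lintegral_enorm_cosineTransform_le h.le lam hf.1)

end Operator

end CompositeCosine

namespace CompositeCosine

open scoped ENNReal Nat Topology

/-! ### Analyticity of exponential integrals. -/

section Analytic

variable {Ω : Type*} [MeasurableSpace Ω] {μ : Measure Ω}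
  {V : Type*} [NormedAddCommGroup V] [NormedSpace ℂ V]

omit [MeasurableSpace Ω] in
theorem norm_mul_prod_le {g : Ω → ℂ} {ℓ : Ω → V →L[ℂ] ℂ} {B : Ω → ℝ}
    (hB : ∀ ω z, ‖ℓ ω z‖ ≤ B ω * ‖z‖) (k : ℕ) (z : Fin k → V) (ω : Ω) :
    ‖g ω * ((k ! : ℂ)⁻¹ * ∏ j, ℓ ω (z j))‖ ≤ ‖g ω‖ * (B ω ^ k / k !) * ∏ j, ‖z j‖ := by
  have h1 : ‖∏ j, ℓ ω (z j)‖ ≤ B ω ^ k * ∏ j, ‖z j‖ := by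
    rw [norm_prod]
    refine (Finset.prod_le_prod (fun _ _ => norm_nonneg _) fun j _ => hB ω (z j)).trans_eq ?_
    rw [Finset.prod_mul_distrib, Finset.prod_const, Finset.card_univ, Fintype.card_fin]
  rw [norm_mul, norm_mul, norm_inv, Complex.norm_natCast]
  calc ‖g ω‖ * ((k ! : ℝ)⁻¹ * ‖∏ j, ℓ ω (z j)‖)
      ≤ ‖g ω‖ * ((k ! : ℝ)⁻¹ * (B ω ^ k * ∏ j, ‖z j‖)) := by gcongr
    _ = _ := by ring

/-- An exponential integral depending linearly on a parameter is analytic at the origin, as soon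
as it is absolutely convergent on a neighbourhood of the origin. -/
theorem analyticAt_integral_mul_exp {g : Ω → ℂ} {ℓ : Ω → V →L[ℂ] ℂ} {B : Ω → ℝ} {r : ℝ}
    (hr : 0 < r) (hg : AEStronglyMeasurable g μ)
    (hℓ : ∀ z, AEStronglyMeasurable (fun ω => ℓ ω z) μ)
    (hBm : AEStronglyMeasurable B μ) (hB0 : ∀ ω, 0 ≤ B ω)
    (hB : ∀ ω z, ‖ℓ ω z‖ ≤ B ω * ‖z‖)
    (hint : Integrable (fun ω => ‖g ω‖ * Real.exp (r * B ω)) μ) :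
    AnalyticAt ℂ (fun z => ∫ ω, g ω * Complex.exp (ℓ ω z) ∂μ) 0 := by
  -- A single term of the exponential series: one integrable majorant controls every Taylor
  -- coefficient and gives radius at least `r`.
  have hterm : ∀ k ω, B ω ^ k / k ! * r ^ k ≤ Real.exp (r * B ω) := by
    intro k ω
    have h := Real.pow_div_factorial_le_exp (r * B ω) (mul_nonneg hr.le (hB0 ω)) k
    rwa [mul_pow, mul_comm (r ^ k), mul_div_right_comm] at h
  have hBint : ∀ k : ℕ, Integrable (fun ω => ‖g ω‖ * (B ω ^ k / k !)) μ := by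
    intro k
    have hpow : AEStronglyMeasurable (fun ω => B ω ^ k / k !) μ :=
      (by fun_prop : Continuous fun x : ℝ => x ^ k / k !).comp_aestronglyMeasurable hBm
    refine (hint.const_mul ((r ^ k)⁻¹)).mono' (hg.norm.mul hpow) (.of_forall fun ω => ?_)
    rw [Real.norm_of_nonneg (mul_nonneg (norm_nonneg _)
      (div_nonneg (pow_nonneg (hB0 ω) k) (Nat.cast_nonneg _))), mul_left_comm]
    refine mul_le_mul_of_nonneg_left ?_ (norm_nonneg _)
    rw [le_inv_mul_iff₀ (pow_pos hr k), mul_comm]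
    exact hterm k ω
  have hFint : ∀ (k : ℕ) (z : Fin k → V),
      Integrable (fun ω => g ω * ((k ! : ℂ)⁻¹ * ∏ j, ℓ ω (z j))) μ := by
    intro k z
    refine ((hBint k).mul_const (∏ j, ‖z j‖)).mono' ?_ (.of_forall fun ω =>
      norm_mul_prod_le hB k z ω)
    refine hg.mul (AEStronglyMeasurable.const_mul ?_ _)
    exact Finset.aestronglyMeasurable_fun_prod _ fun j _ => hℓ (z j)
  let M : ∀ k : ℕ, MultilinearMap ℂ (fun _ : Fin k => V) ℂ := fun k =>
    { toFun := fun z => ∫ ω, g ω * ((k ! : ℂ)⁻¹ * ∏ j, ℓ ω (z j)) ∂μ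
      map_update_add' := fun {inst} z i x y => by
        obtain rfl : inst = instDecidableEqFin k := Subsingleton.elim _ _
        rw [← integral_add (hFint k _) (hFint k _)]
        refine integral_congr_ae (.of_forall fun ω => ?_)
        have h := (ContinuousMultilinearMap.mkPiAlgebra ℂ (Fin k) ℂ).toMultilinearMap.compLinearMap
          (fun _ => (ℓ ω : V →ₗ[ℂ] ℂ)) |>.map_update_add z i x y
        simp only [MultilinearMap.compLinearMap_apply, ContinuousMultilinearMap.coe_coe,
          ContinuousMultilinearMap.mkPiAlgebra_apply, ContinuousLinearMap.coe_coe] at h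
        simp only [h]
        ring
      map_update_smul' := fun {inst} z i c x => by
        obtain rfl : inst = instDecidableEqFin k := Subsingleton.elim _ _
        rw [smul_eq_mul, ← integral_const_mul]
        refine integral_congr_ae (.of_forall fun ω => ?_)
        have h := (ContinuousMultilinearMap.mkPiAlgebra ℂ (Fin k) ℂ).toMultilinearMap.compLinearMap
          (fun _ => (ℓ ω : V →ₗ[ℂ] ℂ)) |>.map_update_smul z i c x
        simp only [MultilinearMap.compLinearMap_apply, ContinuousMultilinearMap.coe_coe,
          ContinuousMultilinearMap.mkPiAlgebra_apply, ContinuousLinearMap.coe_coe,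
          smul_eq_mul] at h
        simp only [h]
        ring }
  have hM : ∀ k z, ‖M k z‖ ≤ (∫ ω, ‖g ω‖ * (B ω ^ k / k !) ∂μ) * ∏ j, ‖z j‖ := by
    intro k z
    rw [← integral_mul_const]
    exact norm_integral_le_of_norm_le ((hBint k).mul_const _)
      (.of_forall fun ω => norm_mul_prod_le hB k z ω)
  let p : FormalMultilinearSeries ℂ V ℂ := fun k => (M k).mkContinuous _ (hM k)
  have hpn : ∀ k, ‖p k‖ ≤ ∫ ω, ‖g ω‖ * (B ω ^ k / k !) ∂μ := fun k =>
    MultilinearMap.mkContinuous_norm_le _ (integral_nonneg fun ω => mul_nonneg (norm_nonneg _)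
      (div_nonneg (pow_nonneg (hB0 ω) k) (Nat.cast_nonneg _))) _
  suffices h : HasFPowerSeriesOnBall (fun z => ∫ ω, g ω * Complex.exp (ℓ ω z) ∂μ) p 0
      (ENNReal.ofReal r) from h.analyticAt
  refine ⟨?_, ENNReal.ofReal_pos.2 hr, fun {z} hz => ?_⟩
  · refine p.le_radius_of_bound (∫ ω, ‖g ω‖ * Real.exp (r * B ω) ∂μ) fun k => ?_
    rw [Real.coe_toNNReal r hr.le]
    calc ‖p k‖ * r ^ k ≤ (∫ ω, ‖g ω‖ * (B ω ^ k / k !) ∂μ) * r ^ k := by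
          gcongr
          exact hpn k
      _ ≤ _ := by
          rw [← integral_mul_const]
          refine integral_mono ((hBint k).mul_const _) hint fun ω => ?_
          simp only [mul_assoc]
          exact mul_le_mul_of_nonneg_left (hterm k ω) (norm_nonneg _)
  · have hzr : ‖z‖ < r := by
      rw [Metric.eball_ofReal, Metric.mem_ball, dist_zero_right] at hz
      exact hz
    rw [zero_add]
    refine hasSum_integral_of_dominated_convergence
      (F := fun k ω => g ω * ((k ! : ℂ)⁻¹ * ∏ _j : Fin k, ℓ ω z))
      (fun k ω => ‖g ω‖ * ((r * B ω) ^ k / k !)) (fun k => (hFint k fun _ => z).1)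
      (fun k => .of_forall fun ω => ?_) (.of_forall fun ω => ?_) ?_ (.of_forall fun ω => ?_)
    · refine (norm_mul_prod_le hB k (fun _ => z) ω).trans ?_
      rw [Finset.prod_const, Finset.card_univ, Fintype.card_fin, mul_pow, mul_assoc]
      refine mul_le_mul_of_nonneg_left ?_ (norm_nonneg _)
      rw [mul_comm (r ^ k), mul_div_right_comm]
      exact mul_le_mul_of_nonneg_left (pow_le_pow_left₀ (norm_nonneg _) hzr.le k)
        (div_nonneg (pow_nonneg (hB0 ω) k) (Nat.cast_nonneg _))
    · exact (Real.summable_pow_div_factorial _).mul_left _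
    · refine hint.congr (.of_forall fun ω => ?_)
      simp only
      rw [tsum_mul_left, Real.exp_eq_exp_ℝ, NormedSpace.exp_eq_tsum_div]
    · refine HasSum.mul_left _ ?_
      have h := NormedSpace.expSeries_div_hasSum_exp (ℓ ω z)
      rw [← Complex.exp_eq_exp_ℂ] at h
      simpa [div_eq_inv_mul] using h

end Analytic

/-! ### Analytic dependence of the transform on the exponents. -/

section Kernel

variable {n m : ℕ}

theorem kernel_eq_mul_exp {u v : Stiefel n m} (hpos : ∀ i, 0 < minorRatio (kernelGram u v) i)
    (lam z : Fin m → ℂ) :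
    kernel (lam + z) u v = kernel lam u v *
      Complex.exp (∑ i, ((Real.log (minorRatio (kernelGram u v) i) / 2 : ℝ) : ℂ) * z i) := by
  rw [kernel_eq_prod, kernel_eq_prod, Complex.exp_sum, ← Finset.prod_mul_distrib]
  refine Finset.prod_congr rfl fun i _ => ?_
  have hne : ((minorRatio (kernelGram u v) i : ℝ) : ℂ) ≠ 0 := by exact_mod_cast (hpos i).ne'
  rw [Pi.add_apply, add_div, Complex.cpow_add _ _ hne]
  congr 1
  rw [Complex.cpow_def_of_ne_zero hne, ← Complex.ofReal_log (hpos i).le]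
  congr 1
  push_cast
  ring

/-- The logarithms are nonpositive, so lowering every exponent by `r` produces exactly the majorant
`exp (r * B)` of `analyticAt_integral_mul_exp`. -/
theorem weight_sub_const {u v : Stiefel n m} (hpos : ∀ i, 0 < minorRatio (kernelGram u v) i)
    (a : Fin m → ℝ) {r : ℝ} :
    weight (fun i => a i - r) (kernelGram u v) = weight a (kernelGram u v) *
      ENNReal.ofReal (Real.exp (r * ∑ i, |Real.log (minorRatio (kernelGram u v) i) / 2|)) := by
  rw [Finset.mul_sum, Real.exp_sum, ENNReal.ofReal_prod_of_nonneg fun _ _ => (Real.exp_pos _).le,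
    weight, weight, ← Finset.prod_mul_distrib]
  refine Finset.prod_congr rfl fun i _ => ?_
  have h0 : ENNReal.ofReal (minorRatio (kernelGram u v) i) ≠ 0 :=
    (ENNReal.ofReal_pos.2 (hpos i)).ne'
  have hlog : Real.log (minorRatio (kernelGram u v) i) ≤ 0 :=
    Real.log_nonpos (hpos i).le (minorRatio_kernelGram_le_one u v i)
  rw [sub_div, sub_eq_add_neg, ENNReal.rpow_add _ _ h0 ENNReal.ofReal_ne_top,
    ENNReal.ofReal_rpow_of_pos (p := -(r / 2)) (hpos i), Real.rpow_def_of_pos (hpos i),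
    abs_of_nonpos (by linarith)]
  congr 3
  ring

/-- The transform is analytic in the parameter near any point at which the integral with slightly
smaller real exponents converges. -/
theorem analyticAt_cosineTransform {h : m ≤ n} {f : Stiefel n m → ℂ}
    (hf : AEStronglyMeasurable f (stiefelMeasure h)) {u : Stiefel n m}
    (hpos : ∀ᵐ v ∂(stiefelMeasure h), ∀ i : Fin m, 0 < minorRatio (kernelGram u v) i)
    {lam : Fin m → ℂ} {r : ℝ} (hr : 0 < r)
    (hu : ∫⁻ v, ‖f v‖ₑ * weight (fun i => (lam i).re - r) (kernelGram u v)
      ∂(stiefelMeasure h) < ∞) :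
    AnalyticAt ℂ (fun lam => cosineTransform h lam f u) lam := by
  let c : Stiefel n m → Fin m → ℝ := fun v i => Real.log (minorRatio (kernelGram u v) i) / 2
  have hcm : ∀ i, Measurable fun v => c v i := fun i =>
    (Real.measurable_log.comp (measurable_minorRatio (continuous_kernelGram_right u) i)).div_const _
  let ℓ : Stiefel n m → (Fin m → ℂ) →L[ℂ] ℂ := fun v =>
    ∑ i, (c v i : ℂ) • ContinuousLinearMap.proj i
  have hℓ : ∀ v z, ℓ v z = ∑ i, (c v i : ℂ) * z i := fun v z => by simp [ℓ]
  have hBm : Measurable fun v => ∑ i, |c v i| :=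
    Finset.measurable_sum _ fun i _ => measurable_abs.comp (hcm i)
  have hgm : AEStronglyMeasurable (fun v => f v * kernel lam u v) (stiefelMeasure h) :=
    hf.mul (measurable_kernel_right lam u).aestronglyMeasurable
  have hmain : AnalyticAt ℂ (fun z => ∫ v, f v * kernel lam u v * Complex.exp (ℓ v z)
      ∂(stiefelMeasure h)) 0 := by
    refine analyticAt_integral_mul_exp (B := fun v => ∑ i, |c v i|) hr hgm (fun z => ?_)
      hBm.aestronglyMeasurable (fun v => Finset.sum_nonneg fun _ _ => abs_nonneg _)
      (fun v z => ?_) ⟨?_, ?_⟩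
    · simp_rw [hℓ]
      exact (Finset.measurable_sum _ fun i _ =>
        (Complex.measurable_ofReal.comp (hcm i)).mul_const _).aestronglyMeasurable
    · rw [hℓ, Finset.sum_mul]
      refine (norm_sum_le _ _).trans (Finset.sum_le_sum fun i _ => ?_)
      rw [norm_mul, Complex.norm_real, Real.norm_eq_abs]
      exact mul_le_mul_of_nonneg_left (norm_le_pi_norm z i) (abs_nonneg _)
    · exact hgm.norm.mul (Real.measurable_exp.comp (hBm.const_mul r)).aestronglyMeasurable
    · refine lt_of_eq_of_lt (lintegral_congr_ae ?_) hu
      filter_upwards [hpos] with v hv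
      rw [weight_sub_const hv, enorm_mul, enorm_norm, enorm_mul, enorm_kernel lam hv, mul_assoc,
        Real.enorm_of_nonneg (Real.exp_pos _).le]
  have hcomp : AnalyticAt ℂ (fun lam' => ∫ v, f v * kernel lam u v * Complex.exp (ℓ v (lam' - lam))
      ∂(stiefelMeasure h)) lam :=
    AnalyticAt.comp_of_eq (f := fun lam' => lam' - lam) hmain
      (analyticAt_id.sub analyticAt_const) (sub_self lam)
  refine hcomp.congr (.of_forall fun lam' => ?_)
  refine integral_congr_ae ?_
  filter_upwards [hpos] with v hv
  have h1 := kernel_eq_mul_exp hv lam (lam' - lam)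
  rw [add_sub_cancel] at h1
  rw [h1, hℓ, mul_assoc]

theorem ae_convergesAt_and_analyticOnNhd (h : m < n) {f : Stiefel n m → ℂ}
    (hf : Integrable f (stiefelMeasure h.le)) :
    ∀ᵐ u ∂(stiefelMeasure h.le), (∀ lam ∈ domain m, ConvergesAt h.le lam f u) ∧
      AnalyticOnNhd ℂ (fun lam => cosineTransform h.le lam f u) (domain m) := by
  -- These countably many exponents decrease to the boundary of the domain, which makes the null set
  -- independent of `lam`.
  have hall : ∀ᵐ u ∂(stiefelMeasure h.le), ∀ k : ℕ,
      ∫⁻ v, ‖f v‖ₑ * weight (fun i : Fin m => (i : ℝ) - m + 1 / ((k : ℝ) + 1)) (kernelGram u v)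
        ∂(stiefelMeasure h.le) < ∞ :=
    ae_all_iff.2 fun k => ae_lintegral_mul_weight_lt_top h
      (fun i => lt_add_of_pos_right _ (by positivity)) hf
  filter_upwards [hall, ae_ae_minorRatio_pos h] with u hu hpos
  -- The second `1 / (k + 1)` is room for the radius of the power series at `lam`.
  have hex : ∀ lam ∈ domain m, ∃ k : ℕ, ∀ i : Fin m,
      (i : ℝ) - m + 1 / ((k : ℝ) + 1) ≤ (lam i).re - 1 / ((k : ℝ) + 1) := by
    intro lam hlam
    have h1 : ∀ i : Fin m, ∀ᶠ k : ℕ in Filter.atTop,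
        1 / ((k : ℝ) + 1) < ((lam i).re - (i - m)) / 2 := fun i =>
      tendsto_one_div_add_atTop_nhds_zero_nat.eventually_lt_const
        (by linarith [(mem_domain_iff lam).1 hlam i])
    obtain ⟨k, hk⟩ := (Filter.eventually_all.2 h1).exists
    exact ⟨k, fun i => by linarith [hk i]⟩
  refine ⟨fun lam hlam => ?_, fun lam hlam => ?_⟩
  · obtain ⟨k, hk⟩ := hex lam hlam
    refine convergesAt_of_lintegral_lt_top (fun i => (hk i).trans ?_) hf.1 (hu k)
    exact sub_le_self _ (by positivity)
  · obtain ⟨k, hk⟩ := hex lam hlam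
    refine analyticAt_cosineTransform hf.1 hpos (r := 1 / ((k : ℝ) + 1)) (by positivity) ?_
    refine lt_of_le_of_lt (lintegral_mono fun v => ?_) (hu k)
    exact mul_le_mul_right (weight_kernelGram_antitone hk u v) _

end Kernel

end CompositeCosine

theorem theorem3p2 (n m : ℕ) (hm : 1 ≤ m) (hmn : m < n) :
    -- absolute convergence almost everywhere for all integrable `f`, exactly on the domain
    (∀ lam : Fin m → ℂ,
      (∀ f : CompositeCosine.Stiefel n m → ℂ,
          Integrable f (CompositeCosine.stiefelMeasure hmn.le) →
          ∀ᵐ u ∂(CompositeCosine.stiefelMeasure hmn.le),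
            CompositeCosine.ConvergesAt hmn.le lam f u) ↔
        lam ∈ CompositeCosine.domain m) ∧
    -- analyticity in `lam`, with an exceptional null set of points `u` independent of `lam`
    (∀ f : CompositeCosine.Stiefel n m → ℂ,
      Integrable f (CompositeCosine.stiefelMeasure hmn.le) →
      ∀ᵐ u ∂(CompositeCosine.stiefelMeasure hmn.le),
        (∀ lam ∈ CompositeCosine.domain m, CompositeCosine.ConvergesAt hmn.le lam f u) ∧
        AnalyticOnNhd ℂ (fun lam => CompositeCosine.cosineTransform hmn.le lam f u)
          (CompositeCosine.domain m)) ∧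
    -- the transform is a bounded linear operator on `L¹`
    (∀ lam ∈ CompositeCosine.domain m,
      ∃ L : Lp ℂ 1 (CompositeCosine.stiefelMeasure (n := n) hmn.le) →L[ℂ]
          Lp ℂ 1 (CompositeCosine.stiefelMeasure (n := n) hmn.le),
        ∀ f : Lp ℂ 1 (CompositeCosine.stiefelMeasure (n := n) hmn.le),
          (L f : CompositeCosine.Stiefel n m → ℂ)
            =ᵐ[CompositeCosine.stiefelMeasure hmn.le]
          CompositeCosine.cosineTransform hmn.le lam f) := by
  exact ⟨fun lam => CompositeCosine.ae_convergesAt_iff_mem_domain hmn lam,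
    fun _ hf => CompositeCosine.ae_convergesAt_and_analyticOnNhd hmn hf,
    fun _ hlam => CompositeCosine.exists_continuousLinearMap_eq_cosineTransform hmn hlam⟩
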